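/- Fix $T>0$, $p_0\in(0,1)$ and $\lambda_{\rm on},\lambda_{\rm off}>0$. Let $G_N(t)$, $t\in[0,T]$, be the dynamic Erdős–Rényi graph on $\{1,\dots,N\}$ with adjacency matrix $A_N(t)=(a_{ij}(t))_{i,j\le N}$. Here $a_{ij}(t)=a_{ji}(t)\in\{0,1\}$, self-loops are allowed, and the processes $a_{ij}$, $i\le j$, are independent. Each $a_{ij}(0)$ equals $1$ with probability $p_0$ and $0$ otherwise. After time $0$ the edge alternates between present ($a_{ij}=1$) and absent ($a_{ij}=0$), with independent holding times that are independent of $a_{ij}(0)$ and exponentially distributed, with rate $\lambda_{\rm on}$ when present and rate $\lambda_{\rm off}$ when absent. The graphs for all $N\ge 1$ are defined on one probability space, with arbitrary joint dependence between different values of $N$ (for instance, $A_N(t)$ may be the top-left $N\times N$ corner of one infinite array). Let $p(t)=P(a_{ij}(t)=1)$, which does not depend on $i,j,N$, and let $\mu_N(t)$ be the largest eigenvalue of $A_N(t)$. Then there are a constant $\eta>0$, events $\Omega_N$ and random variables $\mathcal G_N(t)$ ($N\ge1$, $t\in[0,T]$) such that, for every $N\ge 1$, $P(\Omega_N^{\rm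 c})\le e^{-\eta(\log N)^2}$ and on $\Omega_N$, simultaneously for all $t\in[0,T]$, $$\mu_N(t)=\mathbb E\,\mu_N(t)+\frac1N\sum_{i,j=1}^N\bigl(a_{ij}(t)-p(t)\bigr)+\mathcal G_N(t)\,\frac{(\log N)^4}{\sqrt N}.$$ Moreover $\limsup_{N\to\infty}\sup_{t\in[0,T]}|\mathcal G_N(t)|<\infty$ almost surely, and the error is bounded by a deterministic constant on $\Omega_N$: there is $C<\infty$ such that, for all sufficiently large $N$, $|\mathcal G_N(t)|\le C$ on $\Omega_N$ for all $t\in[0,T]$. -/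

import Mathlib

open MeasureTheory ProbabilityTheory

/-- Duration of the first `k` on-off cycles of one edge, `T_k = ∑_{ℓ ≤ k} ξ⁰_ℓ + ∑_{ℓ ≤ k} ξ¹_ℓ`.
Here `ξ false` is the sequence of off-times, `ξ true` the sequence of on-times, and sequences are
indexed from `0` (so `ξ b ℓ` is the `(ℓ+1)`-st time of its kind). -/
noncomputable def cycleTime (ξ : Bool → ℕ → ℝ) (k : ℕ) : ℝ :=
  ∑ l ∈ Finset.range k, ξ false l + ∑ l ∈ Finset.range k, ξ true l

open Classical in
/-- The state at time `t` (`1` = present, `0` = absent) of an edge with initial state `b` and holding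
times `ξ`: it is in its initial state if `t ∈ [T_k, T_k + ξ^b_{k+1})` for some `k ≥ 0`, and in the
opposite state otherwise. -/
noncomputable def onOffState (b : Bool) (ξ : Bool → ℕ → ℝ) (t : ℝ) : ℝ :=
  if ∃ k : ℕ, t ∈ Set.Ico (cycleTime ξ k) (cycleTime ξ k + ξ b k) then
    (if b then 1 else 0)
  else
    (if b then 0 else 1)

/-- The random input of the exponential on-off Erdős-Rényi dynamic graph on `N` vertices. The
potential edges are the unordered pairs of vertices, self-loops included. `init e` is the initial
state of the edge `e` (`true` with probability `p₀`), `ξ true e` its sequence of on-times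
(exponential with rate `lon`), `ξ false e` its sequence of off-times (exponential with rate
`loff`), and all these random variables are mutually independent. -/
structure IsOnOffInput {Ω : Type*} [MeasurableSpace Ω] (P : Measure Ω) (p₀ lon loff : ℝ) {N : ℕ}
    (init : Sym2 (Fin N) → Ω → Bool) (ξ : Bool → Sym2 (Fin N) → ℕ → Ω → ℝ) : Prop where
  measurable_init : ∀ e, Measurable (init e)
  measurable_time : ∀ b e l, Measurable (ξ b e l)
  law_init : ∀ e, P {ω | init e ω = true} = ENNReal.ofReal p₀
  law_on : ∀ e l, P.map (ξ true e l) = expMeasure lon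
  law_off : ∀ e l, P.map (ξ false e l) = expMeasure loff
  indep : iIndepFun
    (Sum.elim (fun (e : Sym2 (Fin N)) (ω : Ω) => ((init e ω).toNat : ℝ))
      (fun (x : Bool × Sym2 (Fin N) × ℕ) => ξ x.1 x.2.1 x.2.2)) P

/-- The edge process `a_e(t)`. -/
noncomputable def edgeProcess {Ω : Type*} {N : ℕ}
    (init : Sym2 (Fin N) → Ω → Bool) (ξ : Bool → Sym2 (Fin N) → ℕ → Ω → ℝ)
    (e : Sym2 (Fin N)) (t : ℝ) (ω : Ω) : ℝ :=
  onOffState (init e ω) (fun b l => ξ b e l ω) t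

/-- `p(t) = P(a_e(t) = 1)`; its value depends neither on the edge `e` nor on `N`. -/
noncomputable def edgeProb {Ω : Type*} [MeasurableSpace Ω] (P : Measure Ω) {N : ℕ}
    (init : Sym2 (Fin N) → Ω → Bool) (ξ : Bool → Sym2 (Fin N) → ℕ → Ω → ℝ)
    (e : Sym2 (Fin N)) (t : ℝ) : ℝ :=
  P.real {ω | edgeProcess init ξ e t ω = 1}

/-- The adjacency matrix `A_N(t)`, with entries `a_{ij}(t) = a_{ji}(t)`. -/
noncomputable def adjacencyProcess {Ω : Type*} {N : ℕ}
    (init : Sym2 (Fin N) → Ω → Bool) (ξ : Bool → Sym2 (Fin N) → ℕ → Ω → ℝ)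
    (t : ℝ) (ω : Ω) : Matrix (Fin N) (Fin N) ℝ :=
  Matrix.of fun i j => edgeProcess init ξ s(i, j) t ω

/-- The principal (largest) eigenvalue of a real symmetric matrix. -/
noncomputable def principalEigenvalue {N : ℕ} (A : Matrix (Fin N) (Fin N) ℝ) : ℝ :=
  sSup (spectrum ℝ A)

/-- For symmetric `A` of size at least one, the supremum is attained: it is the largest eigenvalue. -/
theorem isGreatest_principalEigenvalue {N : ℕ} (hN : 1 ≤ N) (A : Matrix (Fin N) (Fin N) ℝ)
    (hA : A.IsHermitian) :
    IsGreatest {x : ℝ | Module.End.HasEigenvalue (Matrix.toLin' A) x} (principalEigenvalue A) := by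
  have h : {x : ℝ | Module.End.HasEigenvalue (Matrix.toLin' A) x} = spectrum ℝ A := by
    ext x
    rw [Set.mem_ofPred_eq, Module.End.hasEigenvalue_iff_mem_spectrum, Matrix.spectrum_toLin']
  rw [h]
  have hs := hA.spectrum_real_eq_range_eigenvalues
  have hne : Nonempty (Fin N) := ⟨⟨0, hN⟩⟩
  have hfin : (spectrum ℝ A).Finite := by rw [hs]; exact Set.finite_range _
  have hnon : (spectrum ℝ A).Nonempty := by rw [hs]; exact Set.range_nonempty _
  exact ⟨hnon.csSup_mem hfin, fun x hx => le_csSup hfin.bddAbove hx⟩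

/-!
Let `e` be the constant unit vector and write `A(t) = N p(t) e eᵀ + W(t)` with `W(t)` centred. As
soon as `‖W‖` is of order `√N`, the eigenvalue equation for the top eigenvector, normalised by
`⟪e, u⟫ = 1` and paired with `e`, `W e` and `W² e`, gives
`μ = N p + ⟪W e, e⟫ + ‖W e‖² / (N p) + O(1 / √N)`. The second term is exactly the linear statistic
`N⁻¹ ∑ (a_ij - p)`, so it remains to see that `‖W e‖²`, which is of order `N`, fluctuates only on
the scale `√N (log N)²`. This follows from McDiarmid's inequality after truncating the row sums of
`W` at `√N log N`.

At a fixed time this shows that `μ` minus the linear statistic is within `O((log N)² / √N)` of a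
deterministic number, which may be taken to be its mean because everything is polynomially bounded
off the good event. Uniformity in time comes from a grid of `N² + 1` times: between neighbouring
grid points `p` moves by `O(N⁻²)` and, up to an event of probability `exp (-c (log N)²)`, only
`(log N)²` edges switch.
-/

open scoped NNReal

section SubGaussian

variable {Ω : Type*} [MeasurableSpace Ω] {μ : Measure Ω} {X : Ω → ℝ} {c d : ℝ≥0}

theorem hasSubgaussianMGF_mono (h : HasSubgaussianMGF X c μ) (hcd : c ≤ d) :
    HasSubgaussianMGF X d μ where
  integrable_exp_mul := h.integrable_exp_mul
  mgf_le t := (h.mgf_le t).trans (by gcongr)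

theorem measureReal_le_abs_le_of_hasSubgaussianMGF [IsFiniteMeasure μ]
    (h : HasSubgaussianMGF X c μ) {a : ℝ} (ha : 0 ≤ a) :
    μ.real {ω | a ≤ |X ω|} ≤ 2 * Real.exp (-a ^ 2 / (2 * c)) := by
  calc μ.real {ω | a ≤ |X ω|} ≤ μ.real ({ω | a ≤ X ω} ∪ {ω | a ≤ (-X) ω}) :=
        measureReal_mono fun ω (hω : a ≤ |X ω|) => le_abs.1 hω
    _ ≤ μ.real {ω | a ≤ X ω} + μ.real {ω | a ≤ (-X) ω} := measureReal_union_le _ _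
    _ ≤ 2 * Real.exp (-a ^ 2 / (2 * c)) := by
        rw [two_mul]
        exact add_le_add (h.measure_ge_le ha) (h.neg.measure_ge_le ha)

end SubGaussian

section McDiarmid

/-- Changing the `i`-th coordinate alone changes `f` by at most `c i`, the hypothesis of McDiarmid's
inequality. -/
def HasBoundedDifferences {ι : Type*} [DecidableEq ι] {α : ι → Type*} (f : (∀ i, α i) → ℝ)
    (c : ι → ℝ≥0) : Prop :=
  ∀ x i a, |f (Function.update x i a) - f x| ≤ c i

section HasBoundedDifferences

variable {ι : Type*} [DecidableEq ι] {α : ι → Type*} {f : (∀ i, α i) → ℝ} {c : ι → ℝ≥0}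

theorem HasBoundedDifferences.abs_sub_le [Fintype ι] (hf : HasBoundedDifferences f c)
    (x y : ∀ i, α i) : |f x - f y| ≤ ∑ i, (c i : ℝ) := by
  suffices h : ∀ s : Finset ι, |f (s.piecewise x y) - f y| ≤ ∑ i ∈ s, (c i : ℝ) by
    simpa only [Finset.piecewise_univ] using h Finset.univ
  intro s
  induction s using Finset.induction_on with
  | empty => simp
  | insert i s hi ih =>
    rw [Finset.piecewise_insert, Finset.sum_insert hi]
    exact (_root_.abs_sub_le _ _ _).trans (add_le_add (hf _ i (x i)) ih)

theorem HasBoundedDifferences.comp_piCongrLeft {κ : Type*} [DecidableEq κ] (e : κ ≃ ι)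
    (hf : HasBoundedDifferences f c) :
    HasBoundedDifferences (fun x => f (Equiv.piCongrLeft α e x)) (fun k => c (e k)) := by
  intro x k a
  convert hf (Equiv.piCongrLeft α e x) (e k) a using 4
  ext i
  obtain ⟨j, rfl⟩ := e.surjective i
  rcases eq_or_ne j k with rfl | h
  · simp
  · simp [h]

end HasBoundedDifferences

section Oscillation

variable {α : Type*} {g : α → ℝ}

theorem exists_forall_mem_Icc_of_abs_sub_le [Nonempty α] {c : ℝ} (h : ∀ a b, |g a - g b| ≤ c) :
    ∃ m, ∀ a, g a ∈ Set.Icc m (m + c) := by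
  have hbdd : BddBelow (Set.range g) := by
    obtain ⟨a₀⟩ := ‹Nonempty α›
    refine ⟨g a₀ - c, ?_⟩
    rintro _ ⟨a, rfl⟩
    linarith [(abs_le.1 (h a a₀)).1]
  refine ⟨⨅ a, g a, fun a => ⟨ciInf_le hbdd a, ?_⟩⟩
  rw [← sub_le_iff_le_add]
  exact le_ciInf fun b => by linarith [(abs_le.1 (h a b)).2]

variable [MeasurableSpace α] {μ : Measure α}

theorem hasSubgaussianMGF_of_abs_sub_le [IsProbabilityMeasure μ] {c : ℝ≥0} (hg : Measurable g)
    (h : ∀ a b, |g a - g b| ≤ c) :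
    HasSubgaussianMGF (fun a => g a - ∫ a', g a' ∂μ) ((c / 2) ^ 2) μ := by
  have : Nonempty α := μ.nonempty_of_neZero
  obtain ⟨m, hm⟩ := exists_forall_mem_Icc_of_abs_sub_le h
  simpa using hasSubgaussianMGF_of_mem_Icc hg.aemeasurable (ae_of_all μ hm)

theorem integrable_of_abs_sub_le [IsFiniteMeasure μ] [Nonempty α] {c : ℝ} (hg : Measurable g)
    (h : ∀ a b, |g a - g b| ≤ c) : Integrable g μ := by
  obtain ⟨m, hm⟩ := exists_forall_mem_Icc_of_abs_sub_le h
  exact Integrable.of_mem_Icc m (m + c) hg.aemeasurable (ae_of_all μ hm)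

theorem integrable_exp_mul_of_abs_sub_le [IsProbabilityMeasure μ] {c : ℝ} (hg : Measurable g)
    (h : ∀ a b, |g a - g b| ≤ c) (m t : ℝ) :
    Integrable (fun x => Real.exp (t * (g x - m))) μ := by
  have : Nonempty α := μ.nonempty_of_neZero
  obtain ⟨b, hb⟩ := exists_forall_mem_Icc_of_abs_sub_le h
  exact integrable_exp_mul_of_mem_Icc (a := b - m) (b := b + c - m) (hg.sub_const m).aemeasurable
    (ae_of_all μ fun a => ⟨sub_le_sub_right (hb a).1 m, sub_le_sub_right (hb a).2 m⟩)

end Oscillation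

/-- The tower step of the martingale argument. -/
theorem hasSubgaussianMGF_prod {α β : Type*} [MeasurableSpace α] [MeasurableSpace β]
    {μ : Measure α} {ν : Measure β} [SFinite μ] [SFinite ν] {f : α × β → ℝ} {g : α → ℝ} {c d : ℝ≥0}
    (hint : ∀ t, Integrable (fun x => Real.exp (t * f x)) (μ.prod ν))
    (hg : HasSubgaussianMGF g c μ)
    (hf : ∀ a, HasSubgaussianMGF (fun b => f (a, b) - g a) d ν) :
    HasSubgaussianMGF f (c + d) (μ.prod ν) where
  integrable_exp_mul := hint
  mgf_le t := by
    calc mgf f (μ.prod ν) t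
        = ∫ a, Real.exp (t * g a) * mgf (fun b => f (a, b) - g a) ν t ∂μ := by
          rw [mgf, integral_prod _ (hint t)]
          refine integral_congr_ae (ae_of_all _ fun a => ?_)
          simp only [mgf]
          rw [← integral_const_mul]
          simp only [← Real.exp_add, ← mul_add, add_sub_cancel]
      _ ≤ ∫ a, Real.exp (t * g a) * Real.exp (d * t ^ 2 / 2) ∂μ := by
          refine integral_mono_of_nonneg (ae_of_all _ fun a => ?_)
            ((hg.integrable_exp_mul t).mul_const _) (ae_of_all _ fun a => ?_)
          · exact mul_nonneg (Real.exp_pos _).le mgf_nonneg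
          · exact mul_le_mul_of_nonneg_left ((hf a).mgf_le t) (Real.exp_pos _).le
      _ ≤ Real.exp (c * t ^ 2 / 2) * Real.exp (d * t ^ 2 / 2) := by
          rw [integral_mul_const]
          exact mul_le_mul_of_nonneg_right (hg.mgf_le t) (Real.exp_pos _).le
      _ = Real.exp ((c + d : ℝ≥0) * t ^ 2 / 2) := by
          rw [← Real.exp_add, NNReal.coe_add]
          ring_nf

theorem hasSubgaussianMGF_prod_of_abs_sub_le {α β : Type*} [MeasurableSpace α]
    [MeasurableSpace β] {μ : Measure α} {ν : Measure β} [IsProbabilityMeasure μ]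
    [IsProbabilityMeasure ν] {f : α × β → ℝ} {C : ℝ} {c d : ℝ≥0} (hfm : Measurable f)
    (hC : ∀ z w, |f z - f w| ≤ C) (hfst : ∀ a a' b, |f (a, b) - f (a', b)| ≤ c)
    (hsnd : ∀ a, HasSubgaussianMGF (fun b => f (a, b) - ∫ b', f (a, b') ∂ν) d ν) :
    HasSubgaussianMGF (fun z => f z - ∫ w, f w ∂μ.prod ν) ((c / 2) ^ 2 + d) (μ.prod ν) := by
  have : Nonempty (α × β) := (μ.prod ν).nonempty_of_neZero
  have : Nonempty β := ν.nonempty_of_neZero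
  have hint : ∀ a, Integrable (fun b => f (a, b)) ν := fun a =>
    integrable_of_abs_sub_le (hfm.comp measurable_prodMk_left) fun _ _ => hC _ _
  rw [integral_prod _ (integrable_of_abs_sub_le hfm hC)]
  refine hasSubgaussianMGF_prod (g := fun a => ∫ b, f (a, b) ∂ν - ∫ a, ∫ b, f (a, b) ∂ν ∂μ)
    (integrable_exp_mul_of_abs_sub_le hfm hC _) ?_ fun a => ?_
  · refine hasSubgaussianMGF_of_abs_sub_le hfm.stronglyMeasurable.integral_prod_right'.measurable
      fun a a' => ?_
    rw [← integral_sub (hint a) (hint a')]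
    simpa using norm_integral_le_of_norm_le_const
      (ae_of_all ν fun b => (Real.norm_eq_abs _).trans_le (hfst a a' b))
  · simpa only [sub_sub_sub_cancel_right] using hsnd a

theorem hasSubgaussianMGF_pi_fin {n : ℕ} {α : Fin n → Type*} [∀ i, MeasurableSpace (α i)]
    (μ : ∀ i, Measure (α i)) [∀ i, IsProbabilityMeasure (μ i)] {f : (∀ i, α i) → ℝ}
    {c : Fin n → ℝ≥0} (hfm : Measurable f) (hf : HasBoundedDifferences f c) :
    HasSubgaussianMGF (fun x => f x - ∫ y, f y ∂Measure.pi μ) (∑ i, (c i / 2) ^ 2)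
      (Measure.pi μ) := by
  induction n with
  | zero => simp [Subsingleton.elim _ (default : ∀ i, α i), HasSubgaussianMGF.fun_zero]
  | succ n ih =>
    let e : (∀ i, α i) ≃ᵐ α 0 × (∀ i : Fin n, α i.succ) := MeasurableEquiv.piFinSuccAbove α 0
    have hpres : MeasurePreserving e (Measure.pi μ) ((μ 0).prod (Measure.pi fun i => μ i.succ)) :=
      measurePreserving_piFinSuccAbove μ 0
    have he : ∀ (a : α 0) (x : ∀ i : Fin n, α i.succ), e.symm (a, x) = Fin.cons a x := fun a x => by
      ext i
      cases i using Fin.cases <;> rfl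
    have hprod := hasSubgaussianMGF_prod_of_abs_sub_le (μ := μ 0)
      (ν := Measure.pi fun i : Fin n => μ i.succ) (f := f ∘ e.symm) (c := c 0)
      (hfm.comp e.symm.measurable) (fun _ _ => hf.abs_sub_le _ _)
      (fun a a' x => by
        simp only [Function.comp_apply, he]
        simpa only [Fin.update_cons_zero] using hf (Fin.cons a' x) 0 a)
      (fun a => ih (fun i => μ i.succ) (hfm.comp (e.symm.measurable.comp measurable_prodMk_left))
        (c := fun i => c i.succ) fun x i b => by
          simp only [Function.comp_apply, he, Fin.cons_update]
          exact hf _ _ _)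
    rw [← hpres.map_eq] at hprod
    rw [Fin.sum_univ_succ]
    simpa [integral_map_equiv, Function.comp_def] using hprod.of_map hpres.aemeasurable

theorem HasBoundedDifferences.hasSubgaussianMGF {ι : Type*} [Fintype ι] [DecidableEq ι]
    {α : ι → Type*} [∀ i, MeasurableSpace (α i)] (μ : ∀ i, Measure (α i))
    [∀ i, IsProbabilityMeasure (μ i)] {f : (∀ i, α i) → ℝ} {c : ι → ℝ≥0}
    (hf : HasBoundedDifferences f c) (hfm : Measurable f) :
    HasSubgaussianMGF (fun x => f x - ∫ y, f y ∂Measure.pi μ) (∑ i, (c i / 2) ^ 2)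
      (Measure.pi μ) := by
  let e := (Fintype.equivFin ι).symm
  have hpres := measurePreserving_piCongrLeft μ e
  have hfin := hasSubgaussianMGF_pi_fin (fun k => μ (e k))
    (hfm.comp (MeasurableEquiv.piCongrLeft α e).measurable) (hf.comp_piCongrLeft e)
  have hid : MeasurePreserving (MeasurableEquiv.piCongrLeft α e).symm _ _ := hpres.symm
  rw [← hid.map_eq] at hfin
  simpa [integral_map_equiv, Function.comp_def, e.sum_comp fun i => (c i / 2) ^ 2]
    using hfin.of_map hid.aemeasurable

end McDiarmid

section MatrixOperator

variable {n : Type*} [Fintype n]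

theorem norm_le_sum_abs (v : EuclideanSpace ℝ n) : ‖v‖ ≤ ∑ i, |v i| := by
  rw [EuclideanSpace.norm_eq]
  refine Real.sqrt_le_iff.2 ⟨by positivity, ?_⟩
  simpa using Finset.sum_sq_le_sq_sum_of_nonneg (s := Finset.univ) (f := fun i => |v i|)
    (fun i _ => abs_nonneg _)

variable [DecidableEq n]

/-- A real matrix acting on Euclidean space. -/
noncomputable abbrev matrixOp (A : Matrix n n ℝ) : EuclideanSpace ℝ n →L[ℝ] EuclideanSpace ℝ n :=
  Matrix.toEuclideanCLM (𝕜 := ℝ) A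

theorem matrixOp_apply (A : Matrix n n ℝ) (v : EuclideanSpace ℝ n) (i : n) :
    matrixOp A v i = ∑ j, A i j * v j := rfl

theorem inner_matrixOp (A : Matrix n n ℝ) (v w : EuclideanSpace ℝ n) :
    inner ℝ (matrixOp A v) w = ∑ i, ∑ j, A i j * (w i * v j) := by
  simp only [PiLp.inner_apply, RCLike.inner_apply, conj_trivial, matrixOp_apply, Finset.mul_sum]
  exact Finset.sum_congr rfl fun i _ => Finset.sum_congr rfl fun j _ => by ring

theorem isSymmetric_matrixOp {A : Matrix n n ℝ} (hA : A.IsHermitian) :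
    (matrixOp A : EuclideanSpace ℝ n →ₗ[ℝ] EuclideanSpace ℝ n).IsSymmetric :=
  Matrix.isSymmetric_toEuclideanLin_iff.2 hA

theorem norm_matrixOp_le_sum_abs (A : Matrix n n ℝ) : ‖matrixOp A‖ ≤ ∑ i, ∑ j, |A i j| := by
  refine ContinuousLinearMap.opNorm_le_bound _ (by positivity) fun v => ?_
  calc ‖matrixOp A v‖ ≤ ∑ i, |∑ j, A i j * v j| := norm_le_sum_abs _
    _ ≤ ∑ i, ∑ j, |A i j| * ‖v‖ := by
        refine Finset.sum_le_sum fun i _ => (Finset.abs_sum_le_sum_abs _ _).trans ?_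
        refine Finset.sum_le_sum fun j _ => ?_
        rw [abs_mul]
        exact mul_le_mul_of_nonneg_left (PiLp.norm_apply_le v j) (abs_nonneg _)
    _ = (∑ i, ∑ j, |A i j|) * ‖v‖ := by simp only [Finset.sum_mul]

end MatrixOperator

section PrincipalEigenvalue

variable {N : ℕ} {A : Matrix (Fin N) (Fin N) ℝ}

theorem exists_principalEigenvector [NeZero N] (hA : A.IsHermitian) :
    ∃ v ≠ 0, matrixOp A v = principalEigenvalue A • v := by
  obtain ⟨v, hv⟩ := (isGreatest_principalEigenvalue NeZero.one_le A hA).1.exists_hasEigenvector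
  refine ⟨WithLp.toLp 2 v, by simpa using hv.2, ?_⟩
  rw [Matrix.toEuclideanCLM_toLp, ← Matrix.toLin'_apply, hv.apply_eq_smul, WithLp.toLp_smul]

open scoped MatrixOrder Matrix.Norms.L2Operator in
theorem inner_matrixOp_le_principalEigenvalue (hA : A.IsHermitian)
    (v : EuclideanSpace ℝ (Fin N)) :
    inner ℝ (matrixOp A v) v ≤ principalEigenvalue A * ‖v‖ ^ 2 := by
  have hle : A ≤ algebraMap ℝ _ (principalEigenvalue A) :=
    le_algebraMap_of_spectrum_le (fun x hx => le_csSup Matrix.finite_real_spectrum.bddAbove hx)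
      hA.isSelfAdjoint
  have h := (Matrix.le_iff.1 hle).dotProduct_mulVec_nonneg v.ofLp
  rw [Matrix.sub_mulVec, dotProduct_sub, Algebra.algebraMap_eq_smul_one, Matrix.smul_mulVec,
    Matrix.one_mulVec] at h
  rw [real_inner_comm, Matrix.inner_toEuclideanCLM, EuclideanSpace.real_norm_sq_eq]
  simpa [dotProduct, Finset.mul_sum, pow_two, mul_left_comm] using h

theorem abs_principalEigenvalue_le_norm [NeZero N] (hA : A.IsHermitian) :
    |principalEigenvalue A| ≤ ‖matrixOp A‖ := by
  obtain ⟨v, hv, h⟩ := exists_principalEigenvector hA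
  have hle := (matrixOp A).le_opNorm v
  rw [h, norm_smul] at hle
  exact le_of_mul_le_mul_right hle (norm_pos_iff.2 hv)

end PrincipalEigenvalue

section OutlierExpansion

variable {E : Type*} [NormedAddCommGroup E] [InnerProductSpace ℝ E] {T : E →L[ℝ] E} {e u v : E}
  {r w μ : ℝ}

theorem exists_inner_eq_one_of_rankOne_eigenvector (hT : ‖T‖ < μ)
    (hv : v ≠ 0) (hev : (r * inner ℝ e v) • e + T v = μ • v) :
    ∃ u, inner ℝ e u = 1 ∧ r • e + T u = μ • u := by
  have hne : inner ℝ e v ≠ 0 := by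
    intro h
    rw [h, mul_zero, zero_smul, zero_add] at hev
    have hle := T.le_opNorm v
    rw [hev, norm_smul] at hle
    exact (hT.trans_le (le_abs_self μ)).not_ge (le_of_mul_le_mul_right hle (norm_pos_iff.2 hv))
  refine ⟨(inner ℝ e v)⁻¹ • v, by rw [inner_smul_right, inv_mul_cancel₀ hne], ?_⟩
  calc r • e + T ((inner ℝ e v)⁻¹ • v) = (inner ℝ e v)⁻¹ • ((r * inner ℝ e v) • e + T v) := by
        rw [map_smul, smul_add, smul_smul]
        congr 2
        field_simp
    _ = μ • (inner ℝ e v)⁻¹ • v := by rw [hev, smul_comm]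

theorem mul_inner_of_rankOne_eigenvector (hu : r • e + T u = μ • u) (a : E) :
    μ * inner ℝ a u = r * inner ℝ a e + inner ℝ a (T u) := by
  rw [← inner_smul_right, ← hu, inner_add_right, inner_smul_right]

theorem norm_le_two_of_rankOne_eigenvector (he : ‖e‖ = 1) (hw : ‖T‖ ≤ w) (hwr : 4 * w ≤ r)
    (hr : 0 < r) (hμ : r - w ≤ μ) (hu : r • e + T u = μ • u) : ‖u‖ ≤ 2 := by
  have hμ0 : 0 ≤ μ := by linarith
  have h : μ * ‖u‖ ≤ r + w * ‖u‖ := by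
    calc μ * ‖u‖ = ‖r • e + T u‖ := by rw [hu, norm_smul, Real.norm_of_nonneg hμ0]
      _ ≤ ‖r • e‖ + ‖T u‖ := norm_add_le _ _
      _ ≤ r + w * ‖u‖ := by
        rw [norm_smul, he, mul_one, Real.norm_of_nonneg hr.le]
        gcongr
        exact T.le_of_opNorm_le hw u
  nlinarith [norm_nonneg u]

section Scalar

variable {q s x₁ x₂ z : ℝ}

theorem abs_second_moment_sub_le (hr : 0 < r) (hμ : 3 / 4 * r ≤ μ) (hμq : μ = r + q)
    (hμs : μ * s = r * x₂ + z) (hq : |q| ≤ 2 * w) (hx₂ : |x₂| ≤ w ^ 2) (hz : |z| ≤ 2 * w ^ 3) :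
    |s - x₂| ≤ 16 / 3 * (w ^ 3 / r) := by
  have hμ0 : 0 < μ := by linarith
  have hw : 0 ≤ w := by linarith [abs_nonneg q]
  have hs : s - x₂ = (z - q * x₂) / μ := by
    rw [eq_div_iff hμ0.ne']
    linear_combination hμs - x₂ * hμq
  rw [hs, abs_div, abs_of_pos hμ0, div_le_iff₀ hμ0]
  calc |z - q * x₂| ≤ |z| + |q| * |x₂| := (abs_sub _ _).trans_eq (by rw [abs_mul])
    _ ≤ 2 * w ^ 3 + 2 * w * w ^ 2 := by gcongr
    _ = 16 / 3 * (w ^ 3 / r) * (3 / 4 * r) := by field_simp; ring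
    _ ≤ 16 / 3 * (w ^ 3 / r) * μ := by gcongr

theorem sq_first_moment_le (hr : 0 < r) (hμ : 3 / 4 * r ≤ μ) (hμq : μ * q = r * x₁ + s)
    (hs : |s| ≤ 2 * w ^ 2) : q ^ 2 ≤ 32 / 9 * (x₁ ^ 2 + 4 * (w ^ 2 / r) ^ 2) := by
  have hμ0 : 0 < μ := by linarith
  have hq : |q| ≤ 4 / 3 * (|x₁| + 2 * (w ^ 2 / r)) := by
    rw [eq_div_of_mul_eq hμ0.ne' ((mul_comm _ _).trans hμq), abs_div, abs_of_pos hμ0,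
      div_le_iff₀ hμ0]
    calc |r * x₁ + s| ≤ r * |x₁| + |s| := (abs_add_le _ _).trans_eq (by rw [abs_mul, abs_of_pos hr])
      _ ≤ r * |x₁| + 2 * w ^ 2 := by gcongr
      _ = 4 / 3 * (|x₁| + 2 * (w ^ 2 / r)) * (3 / 4 * r) := by field_simp
      _ ≤ 4 / 3 * (|x₁| + 2 * (w ^ 2 / r)) * μ := by gcongr
  calc q ^ 2 = |q| ^ 2 := (sq_abs q).symm
    _ ≤ (4 / 3 * (|x₁| + 2 * (w ^ 2 / r))) ^ 2 := by gcongr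
    _ ≤ 32 / 9 * (|x₁| ^ 2 + 4 * (w ^ 2 / r) ^ 2) := by
        nlinarith [sq_nonneg (|x₁| - 2 * (w ^ 2 / r))]
    _ = 32 / 9 * (x₁ ^ 2 + 4 * (w ^ 2 / r) ^ 2) := by rw [sq_abs]

theorem abs_sub_expansion_le_of_moments (hr : 0 < r) (hwr : 4 * w ≤ r) (hμ : 3 / 4 * r ≤ μ)
    (hμ₀ : μ = r + q) (hμ₁ : μ * q = r * x₁ + s) (hμ₂ : μ * s = r * x₂ + z)
    (hq : |q| ≤ 2 * w) (hs : |s| ≤ 2 * w ^ 2) (hz : |z| ≤ 2 * w ^ 3) (hx₂ : |x₂| ≤ w ^ 2) :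
    |μ - r - x₁ - x₂ / r| ≤ 10 * (w ^ 3 / r ^ 2 + x₁ ^ 2 / r) := by
  have hw : 0 ≤ w := by linarith [abs_nonneg q]
  have hid : μ - r - x₁ - x₂ / r = (s - x₂) / r - q ^ 2 / r := by
    field_simp
    linear_combination hμ₁ + (r - q) * hμ₀
  have hlin : |(s - x₂) / r| ≤ 16 / 3 * (w ^ 3 / r ^ 2) := by
    rw [abs_div, abs_of_pos hr, div_le_iff₀ hr]
    exact (abs_second_moment_sub_le hr hμ hμ₀ hμ₂ hq hx₂ hz).trans_eq (by field_simp)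
  have hquart : 4 * (w ^ 2 / r) ^ 2 / r ≤ w ^ 3 / r ^ 2 := by
    calc 4 * (w ^ 2 / r) ^ 2 / r = 4 * w * (w ^ 3 / r ^ 3) := by field_simp
      _ ≤ r * (w ^ 3 / r ^ 3) := by gcongr
      _ = w ^ 3 / r ^ 2 := by field_simp
  have hsq : |q ^ 2 / r| ≤ 32 / 9 * (x₁ ^ 2 / r + w ^ 3 / r ^ 2) := by
    rw [abs_of_nonneg (by positivity)]
    calc q ^ 2 / r ≤ 32 / 9 * (x₁ ^ 2 + 4 * (w ^ 2 / r) ^ 2) / r := by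
          gcongr
          exact sq_first_moment_le hr hμ hμ₁ hs
      _ = 32 / 9 * (x₁ ^ 2 / r + 4 * (w ^ 2 / r) ^ 2 / r) := by ring
      _ ≤ 32 / 9 * (x₁ ^ 2 / r + w ^ 3 / r ^ 2) := by gcongr
  have h₁ : 0 ≤ x₁ ^ 2 / r := by positivity
  have h₂ : 0 ≤ w ^ 3 / r ^ 2 := by positivity
  rw [hid]
  linarith [abs_sub ((s - x₂) / r) (q ^ 2 / r)]

end Scalar

theorem abs_eigenvalue_sub_expansion_le (hT : (T : E →ₗ[ℝ] E).IsSymmetric) (he : ‖e‖ = 1)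
    (hv : v ≠ 0) (hr : 0 < r) (hw : ‖T‖ ≤ w) (hwr : 4 * w ≤ r)
    (hev : (r * inner ℝ e v) • e + T v = μ • v) (hμ : r - w ≤ μ) :
    |μ - r - inner ℝ (T e) e - ‖T e‖ ^ 2 / r| ≤
      10 * (w ^ 3 / r ^ 2 + inner ℝ (T e) e ^ 2 / r) := by
  have hT' : ∀ a b, inner ℝ (T a) b = inner ℝ a (T b) := hT
  obtain ⟨u, hu₁, hu⟩ := exists_inner_eq_one_of_rankOne_eigenvector (by linarith) hv hev
  have hu₂ := norm_le_two_of_rankOne_eigenvector he hw hwr hr hμ hu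
  have hTe : ‖T e‖ ≤ w := T.le_of_opNorm_le_of_le hw he.le |>.trans_eq (mul_one w)
  have hTu : ‖T u‖ ≤ w * 2 := T.le_of_opNorm_le_of_le hw hu₂
  have hTTe : ‖T (T e)‖ ≤ w * w := T.le_of_opNorm_le_of_le hw hTe
  have hw0 : 0 ≤ w := (norm_nonneg _).trans hw
  have hmoment := mul_inner_of_rankOne_eigenvector hu
  have bound : ∀ {a b : E} {c d : ℝ}, 0 ≤ c → ‖a‖ ≤ c → ‖b‖ ≤ d → |inner ℝ a b| ≤ c * d :=
    fun hc ha hb => (abs_real_inner_le_norm _ _).trans (mul_le_mul ha hb (norm_nonneg _) hc)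
  refine abs_sub_expansion_le_of_moments (q := inner ℝ (T e) u) (s := inner ℝ (T e) (T u))
    (z := inner ℝ (T (T e)) (T u)) hr hwr (by linarith) ?_ (hmoment (T e)) ?_
    ((bound hw0 hTe hu₂).trans_eq (by ring)) ((bound hw0 hTe hTu).trans_eq (by ring))
    ((bound (by positivity) hTTe hTu).trans_eq (by ring)) ?_
  · simpa [hu₁, real_inner_self_eq_norm_sq, he, hT'] using hmoment e
  · rw [← real_inner_self_eq_norm_sq, ← hT' (T e) e, ← hmoment, hT' (T e) u]
  · rw [abs_of_nonneg (sq_nonneg _)]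
    gcongr

end OutlierExpansion

section OperatorNorm

variable {E : Type*} [NormedAddCommGroup E] [InnerProductSpace ℝ E] {Ω : Type*}
  [MeasurableSpace Ω] {μ : Measure Ω} {T : Ω → E →L[ℝ] E} {c : ℝ≥0}

theorem exists_mul_norm_le_abs_inner {T : E →L[ℝ] E}
    (hT : (T : E →ₗ[ℝ] E).IsSymmetric) {θ : ℝ} (hθ : θ < 1) :
    ∃ v, ‖v‖ ≤ 1 ∧ θ * ‖T‖ ≤ |inner ℝ (T v) v| := by
  rcases (norm_nonneg T).eq_or_lt with h | h
  · exact ⟨0, by simp, by simp [← h]⟩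
  have hlt : θ * ‖T‖ < ⨆ x, |T.rayleighQuotient x| := by
    rw [← T.norm_eq_iSup_rayleighQuotient hT]
    exact mul_lt_of_lt_one_left h hθ
  obtain ⟨x, hx⟩ := exists_lt_of_lt_ciSup hlt
  refine ⟨‖x‖⁻¹ • x, ?_, hx.le.trans_eq ?_⟩
  · rw [norm_smul, norm_inv, norm_norm]
    exact inv_mul_le_one
  · rw [ContinuousLinearMap.rayleighQuotient, ContinuousLinearMap.reApplyInnerSelf_apply,
      RCLike.re_to_real, map_smul, real_inner_smul_left, real_inner_smul_right]
    congr 1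
    field_simp

theorem abs_inner_sub_inner_le (T : E →L[ℝ] E) (x v : E) :
    |inner ℝ (T x) x - inner ℝ (T v) v| ≤ ‖T‖ * ‖x - v‖ * (‖x‖ + ‖v‖) := by
  have h : inner ℝ (T x) x - inner ℝ (T v) v = inner ℝ (T (x - v)) x + inner ℝ (T v) (x - v) := by
    rw [map_sub, inner_sub_left, inner_sub_right]
    ring
  calc |inner ℝ (T x) x - inner ℝ (T v) v|
      ≤ ‖T (x - v)‖ * ‖x‖ + ‖T v‖ * ‖x - v‖ := by
        rw [h]
        exact (abs_add_le _ _).trans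
          (add_le_add (abs_real_inner_le_norm _ _) (abs_real_inner_le_norm _ _))
    _ ≤ ‖T‖ * ‖x - v‖ * ‖x‖ + ‖T‖ * ‖v‖ * ‖x - v‖ := by
        gcongr <;> exact T.le_opNorm _
    _ = ‖T‖ * ‖x - v‖ * (‖x‖ + ‖v‖) := by ring

theorem lintegral_exp_inner_le (hc : ∀ v, HasSubgaussianMGF (fun ω => inner ℝ (T ω v) v)
      (c * ‖v‖₊ ^ 4) μ) {v : E} (hv : ‖v‖ ≤ 5 / 4) (l : ℝ) :
    ∫⁻ ω, ENNReal.ofReal (Real.exp (l * inner ℝ (T ω v) v)) ∂μ ≤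
      ENNReal.ofReal (Real.exp (5 / 4 * (c * l ^ 2))) := by
  rw [← ofReal_integral_eq_lintegral_ofReal ((hc v).integrable_exp_mul l)
    (ae_of_all _ fun _ => (Real.exp_pos _).le)]
  refine ENNReal.ofReal_le_ofReal (((hc v).mgf_le l).trans (Real.exp_le_exp.2 ?_))
  have hv' : ‖v‖ ^ 4 ≤ 5 / 2 := (pow_le_pow_left₀ (norm_nonneg v) hv 4).trans (by norm_num)
  calc ((c * ‖v‖₊ ^ 4 : ℝ≥0) : ℝ) * l ^ 2 / 2 = ‖v‖ ^ 4 * (c * l ^ 2) / 2 := by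
        push_cast
        ring
    _ ≤ 5 / 2 * (c * l ^ 2) / 2 := by gcongr
    _ = 5 / 4 * (c * l ^ 2) := by ring

variable [MeasurableSpace E] [BorelSpace E]

theorem measurable_exp_inner (hT : StronglyMeasurable T) [SecondCountableTopology E] (l : ℝ) :
    Measurable fun z : Ω × E => ENNReal.ofReal (Real.exp (l * inner ℝ (T z.1 z.2) z.2)) := by
  have hform : StronglyMeasurable fun z : Ω × E => inner ℝ (T z.1 z.2) z.2 :=
    Continuous.comp_stronglyMeasurable (g := fun z : (E →L[ℝ] E) × E => inner ℝ (z.1 z.2) z.2)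
      (by fun_prop) ((hT.comp_measurable measurable_fst).prodMk measurable_snd.stronglyMeasurable)
  exact (Real.measurable_exp.comp (hform.measurable.const_mul l)).ennreal_ofReal

variable [FiniteDimensional ℝ E]

theorem exp_norm_mul_volume_ball_le {T : E →L[ℝ] E}
    (hT : (T : E →ₗ[ℝ] E).IsSymmetric) {l : ℝ} (hl : 0 ≤ l) :
    ENNReal.ofReal (Real.exp (l * (3 / 8 * ‖T‖))) * volume (Metric.ball (0 : E) (1 / 4)) ≤
      ∫⁻ v in Metric.ball (0 : E) (5 / 4), (ENNReal.ofReal (Real.exp (l * inner ℝ (T v) v)) +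
        ENNReal.ofReal (Real.exp (-l * inner ℝ (T v) v))) := by
  obtain ⟨v, hv, hTv⟩ := exists_mul_norm_le_abs_inner hT (θ := 15 / 16) (by norm_num)
  have hsub : Metric.ball v (1 / 4) ⊆ Metric.ball (0 : E) (5 / 4) :=
    Metric.ball_subset_ball' (by rw [dist_zero_right]; linarith)
  have hlow : ∀ x ∈ Metric.ball v (1 / 4), 3 / 8 * ‖T‖ ≤ |inner ℝ (T x) x| := fun x hx => by
    have hxv : ‖x - v‖ ≤ 1 / 4 := (mem_ball_iff_norm.1 hx).le
    have hx' : ‖x‖ ≤ 5 / 4 := (mem_ball_zero_iff.1 (hsub hx)).le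
    have hdiff : |inner ℝ (T x) x - inner ℝ (T v) v| ≤ ‖T‖ * (1 / 4) * (5 / 4 + 1) :=
      (abs_inner_sub_inner_le T x v).trans (by gcongr)
    rw [abs_sub_comm] at hdiff
    linarith [abs_sub_abs_le_abs_sub (inner ℝ (T v) v) (inner ℝ (T x) x)]
  rw [← Measure.addHaar_ball_center volume v (1 / 4), ← setLIntegral_const]
  refine (setLIntegral_mono' measurableSet_ball fun x hx => ?_).trans (lintegral_mono_set hsub)
  rw [← ENNReal.ofReal_add (Real.exp_pos _).le (Real.exp_pos _).le]
  refine ENNReal.ofReal_le_ofReal ?_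
  calc Real.exp (l * (3 / 8 * ‖T‖)) ≤ Real.exp |l * inner ℝ (T x) x| := by
        rw [abs_mul, abs_of_nonneg hl]
        gcongr
        exact hlow x hx
    _ ≤ Real.exp (l * inner ℝ (T x) x) + Real.exp (-l * inner ℝ (T x) x) := by
        rw [neg_mul]
        exact Real.exp_abs_le _

/-- Averaging the quadratic form over a ball replaces the usual union bound over a net. -/
theorem lintegral_exp_norm_le [SFinite μ] (hTm : StronglyMeasurable T)
    (hT : ∀ ω, (T ω : E →ₗ[ℝ] E).IsSymmetric)
    (hc : ∀ v, HasSubgaussianMGF (fun ω => inner ℝ (T ω v) v) (c * ‖v‖₊ ^ 4) μ)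
    {l : ℝ} (hl : 0 ≤ l) :
    ∫⁻ ω, ENNReal.ofReal (Real.exp (l * (3 / 8 * ‖T ω‖))) ∂μ ≤
      5 ^ Module.finrank ℝ E * ENNReal.ofReal (2 * Real.exp (5 / 4 * (c * l ^ 2))) := by
  set V := volume (Metric.ball (0 : E) (1 / 4))
  have hV : volume (Metric.ball (0 : E) (5 / 4)) = 5 ^ Module.finrank ℝ E * V := by
    rw [show (5 / 4 : ℝ) = 5 * (1 / 4) by norm_num, Measure.addHaar_ball_mul_of_pos _ _ (by simp),
      ENNReal.ofReal_pow (by simp), ENNReal.ofReal_ofNat]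
  have hexp := measurable_exp_inner hTm
  have hVpos : V ≠ 0 := (Metric.measure_ball_pos volume 0 (by norm_num)).ne'
  have hVfin : V ≠ ⊤ := measure_ball_lt_top.ne
  refine (ENNReal.mul_le_mul_iff_left hVpos hVfin).1 ?_
  calc (∫⁻ ω, ENNReal.ofReal (Real.exp (l * (3 / 8 * ‖T ω‖))) ∂μ) * V
      ≤ ∫⁻ ω, (∫⁻ v in Metric.ball (0 : E) (5 / 4),
          (ENNReal.ofReal (Real.exp (l * inner ℝ (T ω v) v)) +
            ENNReal.ofReal (Real.exp (-l * inner ℝ (T ω v) v)))) ∂μ := by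
        rw [← lintegral_mul_const' _ _ hVfin]
        exact lintegral_mono fun ω => exp_norm_mul_volume_ball_le (hT ω) hl
    _ = ∫⁻ v in Metric.ball (0 : E) (5 / 4), ∫⁻ ω,
          (ENNReal.ofReal (Real.exp (l * inner ℝ (T ω v) v)) +
            ENNReal.ofReal (Real.exp (-l * inner ℝ (T ω v) v))) ∂μ :=
        lintegral_lintegral_swap ((hexp l).add (hexp (-l))).aemeasurable
    _ ≤ ∫⁻ v in Metric.ball (0 : E) (5 / 4),
          ENNReal.ofReal (2 * Real.exp (5 / 4 * (c * l ^ 2))) := by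
        refine setLIntegral_mono' measurableSet_ball fun v hv => ?_
        have hv' : ‖v‖ ≤ 5 / 4 := (mem_ball_zero_iff.1 hv).le
        have hmeas : Measurable fun ω => ENNReal.ofReal (Real.exp (l * inner ℝ (T ω v) v)) :=
          (hexp l).comp measurable_prodMk_right
        rw [lintegral_add_left hmeas, two_mul,
          ENNReal.ofReal_add (Real.exp_pos _).le (Real.exp_pos _).le]
        exact add_le_add (lintegral_exp_inner_le hc hv' l)
          ((lintegral_exp_inner_le hc hv' (-l)).trans_eq (by rw [neg_sq]))
    _ = 5 ^ Module.finrank ℝ E * ENNReal.ofReal (2 * Real.exp (5 / 4 * (c * l ^ 2))) * V := by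
        rw [setLIntegral_const, hV]
        ring

theorem measureReal_le_norm_le [IsFiniteMeasure μ] (hTm : StronglyMeasurable T)
    (hT : ∀ ω, (T ω : E →ₗ[ℝ] E).IsSymmetric)
    (hc : ∀ v, HasSubgaussianMGF (fun ω => inner ℝ (T ω v) v) (c * ‖v‖₊ ^ 4) μ)
    {l : ℝ} (hl : 0 ≤ l) (a : ℝ) :
    μ.real {ω | a ≤ ‖T ω‖} ≤
      2 * 5 ^ Module.finrank ℝ E * Real.exp (5 / 4 * (c * l ^ 2) - 3 / 8 * (l * a)) := by
  have hmarkov : ENNReal.ofReal (Real.exp (l * (3 / 8 * a))) * μ {ω | a ≤ ‖T ω‖} ≤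
      5 ^ Module.finrank ℝ E * ENNReal.ofReal (2 * Real.exp (5 / 4 * (c * l ^ 2))) := by
    refine le_trans ?_ (lintegral_exp_norm_le hTm hT hc hl)
    have hm : Measurable fun ω => ENNReal.ofReal (Real.exp (l * (3 / 8 * ‖T ω‖))) :=
      (Real.measurable_exp.comp ((hTm.norm.measurable.const_mul _).const_mul l)).ennreal_ofReal
    refine le_trans ?_ (mul_meas_ge_le_lintegral hm (ENNReal.ofReal (Real.exp (l * (3 / 8 * a)))))
    gcongr with ω
    intro (h : a ≤ ‖T ω‖)
    exact ENNReal.ofReal_le_ofReal (Real.exp_le_exp.2 (by gcongr))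
  have hreal := ENNReal.toReal_mono (by finiteness) hmarkov
  rw [ENNReal.toReal_mul, ENNReal.toReal_mul, ENNReal.toReal_ofReal (Real.exp_pos _).le,
    ENNReal.toReal_ofReal (by positivity), ENNReal.toReal_pow, ENNReal.toReal_ofNat] at hreal
  rw [Real.exp_sub, ← mul_div_assoc, le_div_iff₀ (Real.exp_pos _), mul_comm]
  calc Real.exp (3 / 8 * (l * a)) * μ.real {ω | a ≤ ‖T ω‖}
      = Real.exp (l * (3 / 8 * a)) * μ.real {ω | a ≤ ‖T ω‖} := by ring_nf
    _ ≤ _ := hreal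
    _ = _ := by ring

end OperatorNorm

section LinearStatistics

variable {V : Type*}

/-- The adjacency matrix of the graph whose edges are the unordered pairs `e` with `x e = true`. -/
def configMatrix (x : Sym2 V → Bool) : Matrix V V ℝ :=
  Matrix.of fun i j => if x s(i, j) then 1 else 0

/-- The adjacency matrix of a configuration of edges, centered at edge density `p`. -/
def centeredMatrix (p : ℝ) (x : Sym2 V → Bool) : Matrix V V ℝ :=
  Matrix.of fun i j => configMatrix x i j - p

theorem configMatrix_isHermitian (x : Sym2 V → Bool) : (configMatrix x).IsHermitian := by
  ext i j
  simp [configMatrix, Sym2.eq_swap]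

theorem centeredMatrix_isHermitian (p : ℝ) (x : Sym2 V → Bool) :
    (centeredMatrix p x).IsHermitian := by
  ext i j
  simp [centeredMatrix, configMatrix, Sym2.eq_swap]

variable [Fintype V]

/-- The linear statistic `∑ᵢⱼ gᵢⱼ (aᵢⱼ - p)` of a configuration of edges. -/
def linearStat (p : ℝ) (g : V → V → ℝ) (x : Sym2 V → Bool) : ℝ :=
  ∑ i, ∑ j, centeredMatrix p x i j * g i j

theorem sum_sum_mul_sq (v : EuclideanSpace ℝ V) : ∑ i, ∑ j, (v i * v j) ^ 2 = ‖v‖ ^ 4 := by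
  rw [show ‖v‖ ^ 4 = ‖v‖ ^ 2 * ‖v‖ ^ 2 by ring, EuclideanSpace.real_norm_sq_eq, Finset.sum_mul_sum]
  simp only [mul_pow]

variable (μ : Measure Bool) [IsProbabilityMeasure μ]

theorem integral_linearStat (g : V → V → ℝ) :
    ∫ x, linearStat (μ.real {true}) g x ∂Measure.pi (fun _ : Sym2 V => μ) = 0 := by
  have hedge : ∀ e : Sym2 V,
      ∫ x, (if x e then 1 else 0 : ℝ) ∂Measure.pi (fun _ : Sym2 V => μ) = μ.real {true} := by
    intro e
    rw [integral_comp_eval (μ := fun _ : Sym2 V => μ) (i := e)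
      (f := fun b : Bool => (if b then 1 else 0 : ℝ)) (by fun_prop)]
    simp [integral_fintype]
  simp only [linearStat]
  rw [integral_finsetSum _ fun _ _ => .of_finite]
  refine Finset.sum_eq_zero fun i _ => ?_
  rw [integral_finsetSum _ fun _ _ => .of_finite]
  refine Finset.sum_eq_zero fun j _ => ?_
  simp only [centeredMatrix, configMatrix, Matrix.of_apply]
  rw [integral_mul_const, integral_sub .of_finite .of_finite, hedge]
  simp

section EdgeWeight

variable [DecidableEq V]

/-- The total absolute weight of an edge in the linear statistic with coefficients `g`; an edge
joining distinct vertices occurs twice. -/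
def edgeWeight (g : V → V → ℝ) (e : Sym2 V) : ℝ≥0 :=
  ∑ q : V × V with s(q.1, q.2) = e, ‖g q.1 q.2‖₊

theorem card_filter_sym2_mk_eq_le (e : Sym2 V) :
    (Finset.univ.filter fun q : V × V => s(q.1, q.2) = e).card ≤ 2 := by
  induction e using Sym2.inductionOn with
  | _ a b =>
    refine (Finset.card_le_card (t := {(a, b), (b, a)}) fun q hq => ?_).trans Finset.card_le_two
    simpa [Prod.ext_iff] using hq

theorem sum_edgeWeight_sq_le (g : V → V → ℝ) :
    ∑ e, (edgeWeight g e : ℝ) ^ 2 ≤ 2 * ∑ i, ∑ j, g i j ^ 2 := by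
  calc ∑ e, (edgeWeight g e : ℝ) ^ 2
      ≤ ∑ e, ∑ q : V × V with s(q.1, q.2) = e, 2 * g q.1 q.2 ^ 2 := by
        refine Finset.sum_le_sum fun e _ => ?_
        rw [edgeWeight, NNReal.coe_sum]
        refine sq_sum_le_card_mul_sum_sq.trans ?_
        simp only [coe_nnnorm, Real.norm_eq_abs, sq_abs, ← Finset.mul_sum]
        gcongr
        exact_mod_cast card_filter_sym2_mk_eq_le e
    _ = 2 * ∑ i, ∑ j, g i j ^ 2 := by
        rw [Finset.sum_fiberwise, Fintype.sum_prod_type]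
        simp only [Finset.mul_sum]

theorem hasBoundedDifferences_linearStat (p : ℝ) (g : V → V → ℝ) :
    HasBoundedDifferences (linearStat p g) (edgeWeight g) := by
  intro x e b
  simp only [linearStat, edgeWeight, NNReal.coe_sum, coe_nnnorm, Real.norm_eq_abs]
  rw [← Fintype.sum_prod_type'
      (f := fun i j => centeredMatrix p (Function.update x e b) i j * g i j),
    ← Fintype.sum_prod_type' (f := fun i j => centeredMatrix p x i j * g i j),
    ← Finset.sum_sub_distrib, Finset.sum_filter]
  refine (Finset.abs_sum_le_sum_abs _ _).trans (Finset.sum_le_sum fun q _ => ?_)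
  rw [← sub_mul, abs_mul]
  split_ifs with h
  · refine mul_le_of_le_one_left (abs_nonneg _) ?_
    simp only [centeredMatrix, configMatrix, Matrix.of_apply, sub_sub_sub_cancel_right]
    split_ifs <;> norm_num
  · simp [centeredMatrix, configMatrix, Function.update_of_ne h]

end EdgeWeight

theorem hasSubgaussianMGF_linearStat {g : V → V → ℝ} {c : ℝ≥0}
    (hg : ∑ i, ∑ j, g i j ^ 2 ≤ 2 * c) :
    HasSubgaussianMGF (linearStat (μ.real {true}) g) c (Measure.pi fun _ : Sym2 V => μ) := by
  classical
  have h := (hasBoundedDifferences_linearStat (μ.real {true}) g).hasSubgaussianMGF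
    (fun _ => μ) (measurable_of_finite _)
  simp only [integral_linearStat, sub_zero] at h
  refine hasSubgaussianMGF_mono h ?_
  rw [← NNReal.coe_le_coe]
  push_cast
  simp only [div_pow, ← Finset.sum_div]
  linarith [sum_edgeWeight_sq_le g]

variable [DecidableEq V]

theorem inner_centeredMatrix (p : ℝ) (x : Sym2 V → Bool) (v : EuclideanSpace ℝ V) :
    inner ℝ (matrixOp (centeredMatrix p x) v) v = linearStat p (fun i j => v i * v j) x :=
  inner_matrixOp _ _ _

theorem measureReal_le_norm_centeredMatrix_le :
    (Measure.pi fun _ : Sym2 V => μ).real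
        {x | 8 * √(Fintype.card V) ≤ ‖matrixOp (centeredMatrix (μ.real {true}) x)‖} ≤
      2 * Real.exp (-Fintype.card V) := by
  set n := (Fintype.card V : ℝ)
  have hn : 0 ≤ n := Nat.cast_nonneg _
  have hform : ∀ v : EuclideanSpace ℝ V, HasSubgaussianMGF
      (fun x => inner ℝ (matrixOp (centeredMatrix (μ.real {true}) x) v) v)
      (1 / 2 * ‖v‖₊ ^ 4) (Measure.pi fun _ : Sym2 V => μ) := fun v => by
    simp only [inner_centeredMatrix]
    refine hasSubgaussianMGF_linearStat μ ?_
    rw [sum_sum_mul_sq]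
    push_cast
    linarith
  have h5 : (5 : ℝ) ^ Fintype.card V ≤ Real.exp (2 * n) := by
    rw [mul_comm, Real.exp_nat_mul]
    have h2 : (5 : ℝ) ≤ Real.exp 2 := by
      linarith [Real.quadratic_le_exp_of_nonneg (x := 2) (by norm_num)]
    gcongr
  refine (measureReal_le_norm_le (measurable_of_finite _).stronglyMeasurable
    (fun x => isSymmetric_matrixOp (centeredMatrix_isHermitian _ x)) hform
    (by positivity : 0 ≤ 2 * √n) _).trans ?_
  rw [finrank_euclideanSpace, mul_pow, Real.sq_sqrt hn, mul_mul_mul_comm, Real.mul_self_sqrt hn]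
  calc 2 * 5 ^ Fintype.card V *
        Real.exp (5 / 4 * ((1 / 2 : ℝ≥0) * (2 ^ 2 * n)) - 3 / 8 * (2 * 8 * n))
      ≤ 2 * Real.exp (2 * n) *
        Real.exp (5 / 4 * ((1 / 2 : ℝ≥0) * (2 ^ 2 * n)) - 3 / 8 * (2 * 8 * n)) := by gcongr
    _ = 2 * Real.exp (-(3 / 2) * n) := by
        rw [mul_assoc, ← Real.exp_add]
        push_cast
        ring_nf
    _ ≤ 2 * Real.exp (-n) := by
        gcongr
        linarith

end LinearStatistics

section RowStatistics

variable {N : ℕ}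

/-- The unit vector with constant coordinates, the approximate principal eigenvector. -/
noncomputable def constUnit (N : ℕ) : EuclideanSpace ℝ (Fin N) :=
  WithLp.toLp 2 fun _ => (√N)⁻¹

theorem constUnit_apply (i : Fin N) : constUnit N i = (√N)⁻¹ := rfl

theorem norm_constUnit [NeZero N] : ‖constUnit N‖ = 1 := by
  have hN : (N : ℝ) ≠ 0 := NeZero.ne _
  simp [EuclideanSpace.norm_eq, constUnit_apply, hN]

/-- The sum of a row of the centered adjacency matrix. -/
def rowStat (p : ℝ) (i : Fin N) (x : Sym2 (Fin N) → Bool) : ℝ := ∑ j, centeredMatrix p x i j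

/-- The average row sum of the centered adjacency matrix, the first order fluctuation of the
principal eigenvalue. -/
noncomputable def meanStat (p : ℝ) (x : Sym2 (Fin N) → Bool) : ℝ :=
  (N : ℝ)⁻¹ * ∑ i, rowStat p i x

/-- The average of the squared row sums, each one truncated at `M ^ 2`. Without truncation this is
`‖W e‖ ^ 2`, where `W` is the centered adjacency matrix and `e` the constant unit vector. -/
noncomputable def truncStat (M p : ℝ) (x : Sym2 (Fin N) → Bool) : ℝ :=
  (N : ℝ)⁻¹ * ∑ i, min (rowStat p i x ^ 2) (M ^ 2)

theorem rowStat_eq_linearStat (p : ℝ) (i : Fin N) :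
    rowStat p i = linearStat p fun k _ => if k = i then 1 else 0 := by
  ext x
  simp [rowStat, linearStat]

theorem meanStat_eq_linearStat (p : ℝ) :
    meanStat (N := N) p = linearStat p fun _ _ => (N : ℝ)⁻¹ := by
  ext x
  simp only [meanStat, rowStat, linearStat, ← Finset.sum_mul, mul_comm]

theorem matrixOp_constUnit_apply (A : Matrix (Fin N) (Fin N) ℝ) (i : Fin N) :
    matrixOp A (constUnit N) i = (∑ j, A i j) * (√N)⁻¹ := by
  simp only [matrixOp_apply, constUnit_apply, Finset.sum_mul]

theorem inner_matrixOp_constUnit (p : ℝ) (x : Sym2 (Fin N) → Bool) :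
    inner ℝ (matrixOp (centeredMatrix p x) (constUnit N)) (constUnit N) = meanStat p x := by
  rw [inner_centeredMatrix, meanStat_eq_linearStat]
  simp only [constUnit_apply, ← mul_inv, Real.mul_self_sqrt (Nat.cast_nonneg _)]

theorem norm_sq_matrixOp_constUnit (p : ℝ) (x : Sym2 (Fin N) → Bool) :
    ‖matrixOp (centeredMatrix p x) (constUnit N)‖ ^ 2 = (N : ℝ)⁻¹ * ∑ i, rowStat p i x ^ 2 := by
  simp only [EuclideanSpace.real_norm_sq_eq, matrixOp_constUnit_apply, mul_pow, inv_pow,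
    Real.sq_sqrt (Nat.cast_nonneg _), Finset.mul_sum, mul_comm, rowStat]

theorem truncStat_eq_norm_sq {M p : ℝ} {x : Sym2 (Fin N) → Bool}
    (h : ∀ i, |rowStat p i x| ≤ M) :
    truncStat M p x = ‖matrixOp (centeredMatrix p x) (constUnit N)‖ ^ 2 := by
  rw [norm_sq_matrixOp_constUnit, truncStat]
  congr 1
  exact Finset.sum_congr rfl fun i _ =>
    min_eq_left (sq_le_sq' (abs_le.1 (h i)).1 (abs_le.1 (h i)).2)

theorem norm_matrixOp_constUnit_le (A : Matrix (Fin N) (Fin N) ℝ) :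
    ‖matrixOp A (constUnit N)‖ ≤ (∑ i, ∑ j, |A i j|) / √N := by
  refine (norm_le_sum_abs _).trans ?_
  rw [div_eq_mul_inv, Finset.sum_mul]
  refine Finset.sum_le_sum fun i _ => ?_
  rw [matrixOp_constUnit_apply, abs_mul, abs_of_nonneg (inv_nonneg.2 (Real.sqrt_nonneg _))]
  gcongr
  exact Finset.abs_sum_le_sum_abs _ _

theorem matrixOp_configMatrix_apply (p : ℝ) (x : Sym2 (Fin N) → Bool)
    (v : EuclideanSpace ℝ (Fin N)) :
    matrixOp (configMatrix x) v =
      (N * p * inner ℝ (constUnit N) v) • constUnit N + matrixOp (centeredMatrix p x) v := by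
  ext i
  have hN : √(N : ℝ) ≠ 0 := (Real.sqrt_pos.2 (Nat.cast_pos.2 i.pos)).ne'
  simp only [PiLp.add_apply, PiLp.smul_apply, matrixOp_apply, constUnit_apply, smul_eq_mul,
    PiLp.inner_apply, RCLike.inner_apply, conj_trivial, centeredMatrix,
    Matrix.of_apply, sub_mul, Finset.sum_sub_distrib, ← Finset.sum_mul, ← Finset.mul_sum]
  field_simp
  rw [Real.sq_sqrt (Nat.cast_nonneg _)]
  ring

section Truncation

theorem abs_min_sq_sub_le {M : ℝ} (hM : 0 ≤ M) (a b : ℝ) :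
    |min (a ^ 2) (M ^ 2) - min (b ^ 2) (M ^ 2)| ≤ 2 * M * |a - b| := by
  have hmin : ∀ c : ℝ, min (c ^ 2) (M ^ 2) = min |c| M ^ 2 := fun c => by
    rw [← sq_abs c]
    exact ((pow_left_monotoneOn (n := 2)).map_min (abs_nonneg c) hM).symm
  have hdiff : |min |a| M - min |b| M| ≤ |a - b| :=
    (abs_inf_sub_inf_le_abs _ _ _).trans (abs_abs_sub_abs_le _ _)
  have hsum : |min |a| M + min |b| M| ≤ 2 * M := by
    rw [abs_of_nonneg (add_nonneg (le_min (abs_nonneg _) hM) (le_min (abs_nonneg _) hM))]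
    linarith [min_le_right |a| M, min_le_right |b| M]
  rw [hmin, hmin, sq_sub_sq, abs_mul]
  gcongr

theorem sum_edgeWeight_row_le (e : Sym2 (Fin N)) :
    ∑ i, (edgeWeight (fun k _ : Fin N => if k = i then 1 else 0) e : ℝ) ≤ 2 := by
  simp only [edgeWeight, NNReal.coe_sum]
  rw [Finset.sum_comm]
  have hrow : ∀ k : Fin N, ∑ i, ‖(if k = i then 1 else 0 : ℝ)‖ = 1 := fun k => by
    simp [apply_ite]
  simp only [coe_nnnorm, hrow, Finset.sum_const, nsmul_eq_mul, mul_one]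
  exact_mod_cast card_filter_sym2_mk_eq_le e

theorem hasBoundedDifferences_truncStat (M : ℝ≥0) (p : ℝ) :
    HasBoundedDifferences (truncStat (N := N) M p) fun _ => 4 * M / N := by
  intro x e b
  have hrow : ∀ i, |min (rowStat p i (Function.update x e b) ^ 2) ((M : ℝ) ^ 2) -
      min (rowStat p i x ^ 2) ((M : ℝ) ^ 2)| ≤
      2 * M * (edgeWeight (fun k _ : Fin N => if k = i then 1 else 0) e : ℝ) := fun i => by
    refine (abs_min_sq_sub_le M.coe_nonneg _ _).trans ?_
    gcongr
    rw [rowStat_eq_linearStat]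
    exact hasBoundedDifferences_linearStat _ _ _ _ _
  rw [truncStat, truncStat, ← mul_sub, ← Finset.sum_sub_distrib, abs_mul,
    abs_of_nonneg (by positivity)]
  calc (N : ℝ)⁻¹ * |∑ i, (min (rowStat p i (Function.update x e b) ^ 2) ((M : ℝ) ^ 2) -
          min (rowStat p i x ^ 2) ((M : ℝ) ^ 2))|
      ≤ (N : ℝ)⁻¹ * ∑ i, 2 * M *
          (edgeWeight (fun k _ : Fin N => if k = i then 1 else 0) e : ℝ) := by
        gcongr
        exact (Finset.abs_sum_le_sum_abs _ _).trans (Finset.sum_le_sum fun i _ => hrow i)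
    _ ≤ (N : ℝ)⁻¹ * (2 * M * 2) := by
        rw [← Finset.mul_sum]
        gcongr
        exact sum_edgeWeight_row_le e
    _ = (4 * M / N : ℝ≥0) := by
        push_cast
        ring

theorem card_sym2_fin_le : Fintype.card (Sym2 (Fin N)) ≤ N ^ 2 := by
  have h := Fintype.card_le_of_surjective (fun q : Fin N × Fin N => s(q.1, q.2))
    Sym2.mk_surjective
  rwa [Fintype.card_prod, Fintype.card_fin, ← sq] at h

theorem hasSubgaussianMGF_truncStat (μ : Measure Bool) [IsProbabilityMeasure μ] (M : ℝ≥0) (p : ℝ) :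
    HasSubgaussianMGF
      (fun x => truncStat (N := N) M p x - ∫ y, truncStat (N := N) M p y ∂Measure.pi fun _ => μ)
      (4 * M ^ 2) (Measure.pi fun _ : Sym2 (Fin N) => μ) := by
  refine hasSubgaussianMGF_mono ((hasBoundedDifferences_truncStat M p).hasSubgaussianMGF
    (fun _ => μ) (measurable_of_finite _)) ?_
  rcases eq_or_ne N 0 with rfl | hN
  · simp
  have hN : (N : ℝ≥0) ≠ 0 := Nat.cast_ne_zero.2 hN
  calc ∑ _ : Sym2 (Fin N), (4 * M / N / 2) ^ 2
      = Fintype.card (Sym2 (Fin N)) * (4 * M / N / 2) ^ 2 := by simp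
    _ ≤ (N : ℝ≥0) ^ 2 * (4 * M / N / 2) ^ 2 := by
        gcongr
        exact_mod_cast card_sym2_fin_le
    _ = 4 * M ^ 2 := by
        field_simp
        ring

end Truncation

end RowStatistics

section TypicalConfigurations

variable {N : ℕ} {w ℓ δ m p p' : ℝ} {x y : Sym2 (Fin N) → Bool}

/-- The centered adjacency matrix `W` of the configuration `x` satisfies the bounds under which the
principal eigenvalue is expanded: `‖W‖ ≤ w`, `|⟪W e, e⟫| ≤ ℓ` and `‖W e‖ ^ 2` is within `δ` of `m`,
where `e` is the constant unit vector. -/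
structure IsTypicalConfig (w ℓ δ m p : ℝ) (x : Sym2 (Fin N) → Bool) : Prop where
  norm_le : ‖matrixOp (centeredMatrix p x)‖ ≤ w
  abs_meanStat_le : |meanStat p x| ≤ ℓ
  abs_norm_sq_sub_le : |‖matrixOp (centeredMatrix p x) (constUnit N)‖ ^ 2 - m| ≤ δ

theorem measureReal_le_abs_rowStat_le [NeZero N] (μ : Measure Bool) [IsProbabilityMeasure μ]
    (L : ℝ≥0) (i : Fin N) :
    (Measure.pi fun _ : Sym2 (Fin N) => μ).real
      {x | √N * L ≤ |rowStat (μ.real {true}) i x|} ≤ 2 * Real.exp (-L ^ 2) := by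
  have hN : (N : ℝ) ≠ 0 := NeZero.ne _
  have h : HasSubgaussianMGF (rowStat (μ.real {true}) i) (N / 2)
      (Measure.pi fun _ : Sym2 (Fin N) => μ) := by
    rw [rowStat_eq_linearStat]
    refine hasSubgaussianMGF_linearStat μ (le_of_eq ?_)
    simp [mul_div_cancel₀]
  refine (measureReal_le_abs_le_of_hasSubgaussianMGF h (by positivity)).trans_eq ?_
  push_cast
  rw [mul_pow, Real.sq_sqrt (Nat.cast_nonneg _), mul_div_cancel₀ _ two_ne_zero, ← mul_neg,
    mul_div_cancel_left₀ _ hN]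

theorem measureReal_le_abs_meanStat_le [NeZero N] (μ : Measure Bool) [IsProbabilityMeasure μ]
    (L : ℝ≥0) :
    (Measure.pi fun _ : Sym2 (Fin N) => μ).real {x | L ≤ |meanStat (μ.real {true}) x|} ≤
      2 * Real.exp (-L ^ 2) := by
  have hN : (N : ℝ) ≠ 0 := NeZero.ne _
  have h : HasSubgaussianMGF (meanStat (μ.real {true})) (1 / 2)
      (Measure.pi fun _ : Sym2 (Fin N) => μ) := by
    rw [meanStat_eq_linearStat]
    refine hasSubgaussianMGF_linearStat μ (le_of_eq ?_)
    simp [sq, hN]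
  refine (measureReal_le_abs_le_of_hasSubgaussianMGF h L.coe_nonneg).trans_eq ?_
  simp

theorem measureReal_le_abs_truncStat_sub_integral_le [NeZero N] (μ : Measure Bool)
    [IsProbabilityMeasure μ] (L : ℝ≥0) (p : ℝ) :
    (Measure.pi fun _ : Sym2 (Fin N) => μ).real {x | √N * L ^ 2 ≤ |truncStat (√N * L) p x -
      ∫ y, truncStat (N := N) (√N * L) p y ∂Measure.pi fun _ => μ|} ≤
      2 * Real.exp (-L ^ 2 / 8) := by
  have hN : (N : ℝ) ≠ 0 := NeZero.ne _
  have h := hasSubgaussianMGF_truncStat (N := N) μ (NNReal.sqrt N * L) p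
  push_cast at h
  refine (measureReal_le_abs_le_of_hasSubgaussianMGF h (by positivity)).trans_eq ?_
  rcases eq_or_ne L 0 with rfl | hL
  · simp
  have hL : (L : ℝ) ≠ 0 := NNReal.coe_ne_zero.2 hL
  push_cast
  rw [mul_pow, mul_pow, Real.sq_sqrt (Nat.cast_nonneg _)]
  congr 2
  field_simp
  norm_num

theorem measureReal_not_isTypicalConfig_le [NeZero N] (μ : Measure Bool) [IsProbabilityMeasure μ]
    (L : ℝ≥0) :
    (Measure.pi fun _ : Sym2 (Fin N) => μ).real {x | ¬ IsTypicalConfig (8 * √N) L (√N * L ^ 2)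
      (∫ y, truncStat (N := N) (√N * L) (μ.real {true}) y ∂Measure.pi fun _ => μ)
      (μ.real {true}) x} ≤ 2 * Real.exp (-N) + (2 * N + 4) * Real.exp (-L ^ 2 / 8) := by
  set p := μ.real {true}
  set π := Measure.pi fun _ : Sym2 (Fin N) => μ
  set m := ∫ y, truncStat (N := N) (√N * L) p y ∂π
  have hsub : {x : Sym2 (Fin N) → Bool | ¬ IsTypicalConfig (8 * √N) L (√N * L ^ 2) m p x} ⊆
      {x | 8 * √N ≤ ‖matrixOp (centeredMatrix p x)‖} ∪ ((⋃ i, {x | √N * L ≤ |rowStat p i x|}) ∪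
        ({x | L ≤ |meanStat p x|} ∪ {x | √N * L ^ 2 ≤ |truncStat (√N * L) p x - m|})) := by
    intro x (hx : ¬ IsTypicalConfig _ _ _ _ _ x)
    contrapose! hx
    simp only [Set.mem_union, Set.mem_iUnion, Set.mem_ofPred_eq, not_or, not_exists, not_le] at hx
    obtain ⟨hnorm, hrow, hmean, htrunc⟩ := hx
    rw [truncStat_eq_norm_sq fun i => (hrow i).le] at htrunc
    exact ⟨hnorm.le, hmean.le, htrunc.le⟩
  have hexp : Real.exp (-L ^ 2) ≤ Real.exp (-L ^ 2 / 8) :=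
    Real.exp_le_exp.2 (by linarith [sq_nonneg (L : ℝ)])
  have hnorm : π.real {x | 8 * √N ≤ ‖matrixOp (centeredMatrix p x)‖} ≤ 2 * Real.exp (-N) := by
    simpa using measureReal_le_norm_centeredMatrix_le (V := Fin N) μ
  have hrow : π.real (⋃ i, {x | √N * L ≤ |rowStat p i x|}) ≤ N * (2 * Real.exp (-L ^ 2 / 8)) := by
    refine (measureReal_iUnion_fintype_le _).trans ((Finset.sum_le_card_nsmul _ _ _ fun i _ =>
      (measureReal_le_abs_rowStat_le μ L i).trans
        (mul_le_mul_of_nonneg_left hexp zero_le_two)).trans_eq ?_)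
    rw [Finset.card_univ, Fintype.card_fin, nsmul_eq_mul]
  have hmean : π.real {x | L ≤ |meanStat p x|} ≤ 2 * Real.exp (-L ^ 2 / 8) :=
    (measureReal_le_abs_meanStat_le μ L).trans (by gcongr)
  have htrunc : π.real {x | √N * L ^ 2 ≤ |truncStat (√N * L) p x - m|} ≤
      2 * Real.exp (-L ^ 2 / 8) := measureReal_le_abs_truncStat_sub_integral_le μ L p
  refine (measureReal_mono hsub).trans ((measureReal_union_le _ _).trans ?_)
  grw [measureReal_union_le, measureReal_union_le, hnorm, hrow, hmean, htrunc]
  linarith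

theorem sum_abs_centeredMatrix_sub_le {S : Finset (Sym2 (Fin N))} (hS : ∀ e ∉ S, y e = x e) :
    ∑ i, ∑ j, |(centeredMatrix p' y - centeredMatrix p x) i j| ≤
      2 * S.card + N ^ 2 * |p' - p| := by
  classical
  have hentry : ∀ i j : Fin N, |(centeredMatrix p' y - centeredMatrix p x) i j| ≤
      (if s(i, j) ∈ S then 1 else 0) + |p' - p| := fun i j => by
    rw [show (centeredMatrix p' y - centeredMatrix p x) i j =
        (configMatrix y i j - configMatrix x i j) - (p' - p) by
      simp only [centeredMatrix, Matrix.sub_apply, Matrix.of_apply]; ring]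
    refine (abs_sub _ _).trans (add_le_add_left ?_ _)
    simp only [configMatrix, Matrix.of_apply]
    split_ifs <;> simp_all
  have hcard : (Finset.univ.filter fun q : Fin N × Fin N => s(q.1, q.2) ∈ S).card ≤ 2 * S.card :=
    Finset.card_le_mul_card_image_of_maps_to (fun q hq => (Finset.mem_filter.1 hq).2) 2 fun e _ =>
      (Finset.card_le_card (Finset.filter_subset_filter _ (Finset.filter_subset _ _))).trans
        (card_filter_sym2_mk_eq_le e)
  calc ∑ i, ∑ j, |(centeredMatrix p' y - centeredMatrix p x) i j|
      ≤ ∑ q : Fin N × Fin N, ((if s(q.1, q.2) ∈ S then 1 else 0) + |p' - p|) := by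
        rw [Fintype.sum_prod_type]
        exact Finset.sum_le_sum fun i _ => Finset.sum_le_sum fun j _ => hentry i j
    _ = (Finset.univ.filter fun q : Fin N × Fin N => s(q.1, q.2) ∈ S).card +
          N ^ 2 * |p' - p| := by
        simp [Finset.sum_add_distrib, sq]
    _ ≤ 2 * S.card + N ^ 2 * |p' - p| := by
        gcongr
        exact_mod_cast hcard

theorem IsTypicalConfig.of_sum_abs_sub_le [NeZero N] {D : ℝ} (hx : IsTypicalConfig w ℓ δ m p x)
    (hD : ∑ i, ∑ j, |(centeredMatrix p' y - centeredMatrix p x) i j| ≤ D) (hDN : D ≤ √N) :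
    IsTypicalConfig (w + √N) (ℓ + 1) (δ + (2 * w + 1)) m p' y := by
  set B := matrixOp (centeredMatrix p' y - centeredMatrix p x) with hB
  have he : ‖constUnit N‖ = 1 := norm_constUnit
  have hN : (0 : ℝ) < √N := Real.sqrt_pos.2 (Nat.cast_pos.2 (NeZero.pos N))
  have hadd : matrixOp (centeredMatrix p' y) = matrixOp (centeredMatrix p x) + B := by
    rw [hB, matrixOp, matrixOp, matrixOp, map_sub, add_sub_cancel]
  have hBe : ‖B (constUnit N)‖ ≤ 1 :=
    (norm_matrixOp_constUnit_le _).trans ((div_le_one hN).2 (hD.trans hDN))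
  refine ⟨?_, ?_, ?_⟩
  · rw [hadd]
    exact (norm_add_le _ _).trans
      (add_le_add hx.norm_le ((norm_matrixOp_le_sum_abs _).trans (hD.trans hDN)))
  · rw [← inner_matrixOp_constUnit, hadd, add_apply, inner_add_left, inner_matrixOp_constUnit]
    refine (abs_add_le _ _).trans (add_le_add hx.abs_meanStat_le ?_)
    exact (abs_real_inner_le_norm _ _).trans (by rwa [he, mul_one])
  · set a := ‖matrixOp (centeredMatrix p' y) (constUnit N)‖
    set b := ‖matrixOp (centeredMatrix p x) (constUnit N)‖
    have hab : |a - b| ≤ 1 := by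
      refine (abs_norm_sub_norm_le _ _).trans ?_
      rwa [hadd, add_apply, add_sub_cancel_left]
    have hbw : b ≤ w :=
      ((matrixOp (centeredMatrix p x)).unit_le_opNorm _ he.le).trans hx.norm_le
    have hsq : |a ^ 2 - b ^ 2| ≤ 2 * w + 1 := by
      rw [sq_sub_sq, abs_mul, abs_of_nonneg (by positivity)]
      calc (a + b) * |a - b| ≤ (a + b) * 1 := by gcongr
        _ ≤ 2 * w + 1 := by linarith [(abs_le.1 hab).2]
    linarith [abs_sub_le (a ^ 2) (b ^ 2) m, hx.abs_norm_sq_sub_le]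

theorem IsTypicalConfig.abs_principalEigenvalue_sub_le [NeZero N]
    (hx : IsTypicalConfig w ℓ δ m p x) (hp : 0 < p) (hwp : 4 * w ≤ N * p) :
    |principalEigenvalue (configMatrix x) - (N * p + m / (N * p)) - meanStat p x| ≤
      10 * (w ^ 3 / (N * p) ^ 2 + ℓ ^ 2 / (N * p)) + δ / (N * p) := by
  have he : ‖constUnit N‖ = 1 := norm_constUnit
  have hNp : 0 < N * p := mul_pos (Nat.cast_pos.2 (NeZero.pos N)) hp
  obtain ⟨v, hv, hev⟩ := exists_principalEigenvector (configMatrix_isHermitian x)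
  have hlow : N * p - w ≤ principalEigenvalue (configMatrix x) := by
    have hform := inner_matrixOp_le_principalEigenvalue (configMatrix_isHermitian x) (constUnit N)
    rw [matrixOp_configMatrix_apply p, inner_add_left, inner_smul_left, real_inner_self_eq_norm_sq,
      he, conj_trivial, one_pow, mul_one, mul_one, mul_one] at hform
    have hinner := (abs_real_inner_le_norm (matrixOp (centeredMatrix p x) (constUnit N))
      (constUnit N)).trans_eq (by rw [he, mul_one])
    linarith [(abs_le.1 hinner).1, (matrixOp (centeredMatrix p x)).unit_le_opNorm _ he.le,
      hx.norm_le]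
  rw [matrixOp_configMatrix_apply p] at hev
  have hexp := abs_eigenvalue_sub_expansion_le
    (isSymmetric_matrixOp (centeredMatrix_isHermitian p x)) he hv hNp hx.norm_le hwp hev hlow
  rw [inner_matrixOp_constUnit] at hexp
  set X := ‖matrixOp (centeredMatrix p x) (constUnit N)‖ ^ 2
  have hX : |(X - m) / (N * p)| ≤ δ / (N * p) := by
    rw [abs_div, abs_of_pos hNp]
    gcongr
    exact hx.abs_norm_sq_sub_le
  have hmean : meanStat p x ^ 2 ≤ ℓ ^ 2 := sq_le_sq.2 (hx.abs_meanStat_le.trans (le_abs_self _))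
  calc |principalEigenvalue (configMatrix x) - (N * p + m / (N * p)) - meanStat p x|
      = |(principalEigenvalue (configMatrix x) - N * p - meanStat p x - X / (N * p)) +
          (X - m) / (N * p)| := by ring_nf
    _ ≤ 10 * (w ^ 3 / (N * p) ^ 2 + meanStat p x ^ 2 / (N * p)) + δ / (N * p) :=
        (abs_add_le _ _).trans (add_le_add hexp hX)
    _ ≤ 10 * (w ^ 3 / (N * p) ^ 2 + ℓ ^ 2 / (N * p)) + δ / (N * p) := by gcongr

theorem expansion_error_le {c L : ℝ} (hN : 1 ≤ N) (hL : 1 ≤ L) (hc : 0 < c) (hcp : c ≤ p)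
    (hp : p ≤ 1) :
    10 * ((9 * √N) ^ 3 / (N * p) ^ 2 + (2 * L) ^ 2 / (N * p)) +
      18 * (√N * L ^ 2) / (N * p) ≤ 7400 / c ^ 2 * (L ^ 2 / √N) := by
  set q := √(N : ℝ)
  have hq : 1 ≤ q := Real.one_le_sqrt.2 (Nat.one_le_cast.2 hN)
  have hNq : (N : ℝ) = q ^ 2 := (Real.sq_sqrt (Nat.cast_nonneg _)).symm
  have hL2 : 1 ≤ L ^ 2 := one_le_pow₀ hL
  have hqq : q ≤ q ^ 2 := le_self_pow₀ hq two_ne_zero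
  have hcc : 1 / c ≤ 1 / c ^ 2 :=
    one_div_le_one_div_of_le (by positivity) (pow_le_of_le_one hc.le (hcp.trans hp) two_ne_zero)
  have hcube : (9 * q) ^ 3 / (N * p) ^ 2 ≤ 729 * (1 / c ^ 2 * (L ^ 2 / q)) := by
    calc (9 * q) ^ 3 / (N * p) ^ 2 ≤ (9 * q) ^ 3 / (N * c) ^ 2 := by gcongr
      _ = 729 * (1 / c ^ 2 * (1 / q)) := by rw [hNq]; field_simp; norm_num
      _ ≤ 729 * (1 / c ^ 2 * (L ^ 2 / q)) := by gcongr
  have hmean : (2 * L) ^ 2 / (N * p) ≤ 4 * (1 / c ^ 2 * (L ^ 2 / q)) := by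
    calc (2 * L) ^ 2 / (N * p) ≤ (2 * L) ^ 2 / (N * c) := by gcongr
      _ = 4 * (1 / c * (L ^ 2 / q ^ 2)) := by rw [hNq]; field_simp; norm_num
      _ ≤ 4 * (1 / c ^ 2 * (L ^ 2 / q)) := by gcongr
  have htrunc : 18 * (q * L ^ 2) / (N * p) ≤ 18 * (1 / c ^ 2 * (L ^ 2 / q)) := by
    calc 18 * (q * L ^ 2) / (N * p) ≤ 18 * (q * L ^ 2) / (N * c) := by gcongr
      _ = 18 * (1 / c * (L ^ 2 / q)) := by rw [hNq]; field_simp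
      _ ≤ 18 * (1 / c ^ 2 * (L ^ 2 / q)) := by gcongr
  rw [show 7400 / c ^ 2 * (L ^ 2 / q) = 7400 * (1 / c ^ 2 * (L ^ 2 / q)) by ring]
  have hpos : 0 ≤ 1 / c ^ 2 * (L ^ 2 / q) := by positivity
  linarith

theorem IsTypicalConfig.abs_principalEigenvalue_sub_le_of_near [NeZero N] {L c : ℝ}
    {S : Finset (Sym2 (Fin N))} (hx : IsTypicalConfig (8 * √N) L (√N * L ^ 2) m p x)
    (hS : ∀ e ∉ S, y e = x e) (hD : 2 * S.card + N ^ 2 * |p' - p| ≤ √N) (hL : 1 ≤ L)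
    (hc : 0 < c) (hcp : c ≤ p') (hp' : p' ≤ 1) (hNc : 36 * √N ≤ N * c) :
    |principalEigenvalue (configMatrix y) - (N * p' + m / (N * p')) - meanStat p' y| ≤
      7400 / c ^ 2 * (L ^ 2 / √N) := by
  have hN : 1 ≤ N := NeZero.one_le
  have hq : 1 ≤ √(N : ℝ) := Real.one_le_sqrt.2 (Nat.one_le_cast.2 hN)
  have hL2 : 1 ≤ L ^ 2 := one_le_pow₀ hL
  have hqL : √N ≤ √N * L ^ 2 := le_mul_of_one_le_right (Real.sqrt_nonneg _) hL2
  have hy : IsTypicalConfig (9 * √N) (2 * L) (18 * (√N * L ^ 2)) m p' y := by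
    have h := hx.of_sum_abs_sub_le (sum_abs_centeredMatrix_sub_le hS) hD
    exact ⟨h.norm_le.trans (by linarith), h.abs_meanStat_le.trans (by linarith),
      h.abs_norm_sq_sub_le.trans (by linarith)⟩
  have hNp : N * c ≤ N * p' := by gcongr
  exact (hy.abs_principalEigenvalue_sub_le (hc.trans_le hcp) (by linarith)).trans
    (expansion_error_le hN hL hc hcp hp')

end TypicalConfigurations

section BernoulliConfigurations

variable {ι : Type*} [Fintype ι] (μ : Measure Bool) [IsProbabilityMeasure μ]

theorem mgf_card_true_one_le :
    mgf (fun x : ι → Bool => ((Finset.univ.filter fun i => x i = true).card : ℝ))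
        (Measure.pi fun _ => μ) 1 ≤ Real.exp (2 * μ.real {true} * Fintype.card ι) := by
  have hprod : ∀ x : ι → Bool,
      Real.exp (1 * ((Finset.univ.filter fun i => x i = true).card : ℝ)) =
        ∏ i, if x i then Real.exp 1 else 1 := fun x => by
    simp [Finset.prod_ite, ← Real.exp_nat_mul]
  have hsum : μ.real {false} = 1 - μ.real {true} := by
    rw [← probReal_compl_eq_one_sub (measurableSet_singleton true), Bool.compl_singleton,
      Bool.not_true]
  have hone : ∫ b, (if b then Real.exp 1 else 1) ∂μ ≤ Real.exp (2 * μ.real {true}) := by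
    rw [integral_fintype .of_finite, Fintype.sum_bool, hsum]
    have h3 := mul_le_mul_of_nonneg_left Real.exp_one_lt_three.le
      (measureReal_nonneg (μ := μ) (s := {true}))
    simp only [if_true, smul_eq_mul, Bool.false_eq_true, if_false]
    linarith [Real.add_one_le_exp (2 * μ.real {true})]
  rw [mgf, integral_congr_ae (.of_forall hprod),
    integral_fintype_prod_eq_prod (μ := fun _ : ι => μ) fun _ b => if b then Real.exp 1 else 1,
    Finset.prod_const, Finset.card_univ, mul_comm (2 * _), Real.exp_nat_mul]
  exact pow_le_pow_left₀ (integral_nonneg fun b => by positivity) hone _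

theorem measureReal_le_card_true_le (m : ℝ) :
    (Measure.pi fun _ : ι => μ).real {x | m ≤ (Finset.univ.filter fun i => x i = true).card} ≤
      Real.exp (-m + 2 * μ.real {true} * Fintype.card ι) := by
  refine (measure_ge_le_exp_mul_mgf m zero_le_one .of_finite).trans ?_
  rw [Real.exp_add, neg_one_mul]
  exact mul_le_mul_of_nonneg_left (mgf_card_true_one_le μ) (Real.exp_pos _).le

end BernoulliConfigurations

section ExponentialTimes

theorem expMeasure_Ioc_le {r : ℝ} (hr : 0 < r) (a b : ℝ) :
    expMeasure r (Set.Ioc a b) ≤ ENNReal.ofReal (r * (b - a)) := by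
  have hpdf : ∀ x, exponentialPDF r x ≤ ENNReal.ofReal r := fun x => by
    rw [exponentialPDF_eq]
    refine ENNReal.ofReal_le_ofReal ?_
    split_ifs with hx
    · exact mul_le_of_le_one_right hr.le (Real.exp_le_one_iff.2 (by nlinarith))
    · exact hr.le
  change (volume.withDensity (exponentialPDF r)) (Set.Ioc a b) ≤ _
  rw [withDensity_apply _ measurableSet_Ioc]
  refine (lintegral_mono hpdf).trans_eq ?_
  rw [setLIntegral_const, Real.volume_Ioc, ENNReal.ofReal_mul hr.le]

theorem expMeasure_Iic {r : ℝ} (hr : 0 < r) {t : ℝ} (ht : 0 ≤ t) :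
    expMeasure r (Set.Iic t) = ENNReal.ofReal (1 - Real.exp (-(r * t))) := by
  have := isProbabilityMeasure_expMeasure hr
  rw [← ofReal_cdf, cdf_expMeasure_eq hr, if_pos ht]

theorem one_sub_expMeasure_Iic {r : ℝ} (hr : 0 < r) {t : ℝ} (ht : 0 ≤ t) :
    1 - expMeasure r (Set.Iic t) = ENNReal.ofReal (Real.exp (-(r * t))) := by
  have hle : Real.exp (-(r * t)) ≤ 1 := Real.exp_le_one_iff.2 (neg_nonpos.2 (by positivity))
  rw [expMeasure_Iic hr ht, ← ENNReal.ofReal_one, ← ENNReal.ofReal_sub _ (sub_nonneg.2 hle),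
    sub_sub_cancel]

theorem expMeasure_Iio_zero {r : ℝ} (hr : 0 < r) : expMeasure r (Set.Iio 0) = 0 := by
  refine measure_mono_null Set.Iio_subset_Iic_self ?_
  rw [expMeasure_Iic hr le_rfl]
  simp

variable {Ω : Type*} [MeasurableSpace Ω] {P : Measure Ω} [IsProbabilityMeasure P]

theorem measure_add_mem_Ioc_le {r : ℝ} (hr : 0 < r) {Y Z : Ω → ℝ} (hY : Measurable Y)
    (hZ : Measurable Z) (hYZ : IndepFun Y Z P) (hlaw : P.map Z = expMeasure r) (a b : ℝ) :
    P {ω | Y ω + Z ω ∈ Set.Ioc a b} ≤ ENNReal.ofReal (r * (b - a)) * P {ω | Y ω ≤ b} := by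
  have := isProbabilityMeasure_expMeasure hr
  have := Measure.isProbabilityMeasure_map (μ := P) hY.aemeasurable
  have hm : MeasurableSet {q : ℝ × ℝ | q.1 + q.2 ∈ Set.Ioc a b} :=
    (measurable_fst.add measurable_snd) measurableSet_Ioc
  have hprod : P {ω | Y ω + Z ω ∈ Set.Ioc a b} =
      ((P.map Y).prod (expMeasure r)) {q : ℝ × ℝ | q.1 + q.2 ∈ Set.Ioc a b} := by
    rw [← hlaw, ← (indepFun_iff_map_prod_eq_prod_map_map hY.aemeasurable hZ.aemeasurable).1 hYZ,
      Measure.map_apply (hY.prodMk hZ) hm]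
    rfl
  have hfiber : ∀ y, expMeasure r (Prod.mk y ⁻¹' {q : ℝ × ℝ | q.1 + q.2 ∈ Set.Ioc a b}) ≤
      (Set.Iic b).indicator (fun _ => ENNReal.ofReal (r * (b - a))) y := fun y => by
    by_cases hy : y ∈ Set.Iic b
    · rw [Set.indicator_of_mem hy, ← sub_sub_sub_cancel_right b a y]
      refine (measure_mono fun z (hz : y + z ∈ Set.Ioc a b) => ?_).trans
        (expMeasure_Ioc_le hr (a - y) (b - y))
      exact ⟨by linarith [hz.1], by linarith [hz.2]⟩
    · rw [Set.indicator_of_notMem hy, nonpos_iff_eq_zero]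
      refine measure_mono_null (fun z (hz : y + z ∈ Set.Ioc a b) => ?_) (expMeasure_Iio_zero hr)
      have hy : b < y := not_le.1 hy
      change z < 0
      linarith [hz.2]
  rw [hprod, Measure.prod_apply hm]
  refine (lintegral_mono hfiber).trans_eq ?_
  rw [lintegral_indicator_const measurableSet_Iic, Measure.map_apply hY measurableSet_Iic]
  rfl

end ExponentialTimes

section SwitchingTimes

theorem onOffState_eq_zero_or_one (b : Bool) (ξ : Bool → ℕ → ℝ) (t : ℝ) :
    onOffState b ξ t = 0 ∨ onOffState b ξ t = 1 := by
  unfold onOffState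
  split_ifs <;> simp

theorem cycleTime_zero (ξ : Bool → ℕ → ℝ) : cycleTime ξ 0 = 0 := by
  simp [cycleTime]

theorem cycleTime_succ (ξ : Bool → ℕ → ℝ) (k : ℕ) :
    cycleTime ξ (k + 1) = cycleTime ξ k + ξ false k + ξ true k := by
  simp only [cycleTime, Finset.sum_range_succ]
  ring

theorem cycleTime_eq_sum (ξ : Bool → ℕ → ℝ) (k : ℕ) :
    cycleTime ξ k = ∑ q ∈ Finset.univ ×ˢ Finset.range k, ξ q.1 q.2 := by
  rw [Finset.sum_product, Fintype.sum_bool, cycleTime, add_comm]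

/-- The holding times for which some on- or off-period, for one of the two possible initial states,
ends during `(s, t]`. -/
def switchSet (s t : ℝ) : Set (Bool → ℕ → ℝ) :=
  {ξ | ∃ k, cycleTime ξ (k + 1) ∈ Set.Ioc s t ∨ ∃ b, cycleTime ξ k + ξ b k ∈ Set.Ioc s t}

theorem onOffState_eq_of_notMem_switchSet {s t t' : ℝ} (hs : 0 ≤ s) {ξ : Bool → ℕ → ℝ}
    (h : ξ ∉ switchSet s t') (hst : s ≤ t) (htt' : t ≤ t') (b : Bool) :
    onOffState b ξ t = onOffState b ξ s := by
  have hcycle : ∀ k, cycleTime ξ k ∉ Set.Ioc s t' := by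
    rintro (_ | k) hk
    · exact hs.not_gt (cycleTime_zero ξ ▸ hk.1)
    · exact h ⟨k, Or.inl hk⟩
  have hphase : ∀ k, cycleTime ξ k + ξ b k ∉ Set.Ioc s t' := fun k hk => h ⟨k, Or.inr ⟨b, hk⟩⟩
  have hle : ∀ c : ℝ, c ∉ Set.Ioc s t' → (c ≤ t ↔ c ≤ s) := fun c hc =>
    ⟨fun hct => not_lt.1 fun hsc => hc ⟨hsc, hct.trans htt'⟩, fun hcs => hcs.trans hst⟩
  have hmem : ∀ k, t ∈ Set.Ico (cycleTime ξ k) (cycleTime ξ k + ξ b k) ↔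
      s ∈ Set.Ico (cycleTime ξ k) (cycleTime ξ k + ξ b k) := fun k => by
    rw [Set.mem_Ico, Set.mem_Ico, hle _ (hcycle k), ← not_le, ← not_le, hle _ (hphase k)]
  unfold onOffState
  congr 1
  exact propext (exists_congr hmem)

theorem measurable_cycleTime (k : ℕ) : Measurable fun ξ : Bool → ℕ → ℝ => cycleTime ξ k := by
  unfold cycleTime
  fun_prop

theorem measurable_onOffState (b : Bool) (t : ℝ) : Measurable fun ξ => onOffState b ξ t := by
  unfold onOffState
  refine Measurable.ite ?_ measurable_const measurable_const
  rw [Set.ofPred_exists]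
  refine MeasurableSet.iUnion fun k => ?_
  have hk := measurable_cycleTime k
  exact (measurableSet_le hk measurable_const).inter
    (measurableSet_lt measurable_const (hk.add (by fun_prop)))

theorem switchSet_eq_iUnion (s t : ℝ) :
    switchSet s t = ⋃ k, ({ξ | cycleTime ξ (k + 1) ∈ Set.Ioc s t} ∪
      ⋃ b, {ξ | cycleTime ξ k + ξ b k ∈ Set.Ioc s t}) := by
  ext ξ
  simp [switchSet]

theorem measurableSet_switchSet (s t : ℝ) : MeasurableSet (switchSet s t) := by
  rw [switchSet_eq_iUnion]
  refine .iUnion fun k => .union ?_ (.iUnion fun b => ?_)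
  · exact measurable_cycleTime (k + 1) measurableSet_Ioc
  · exact ((measurable_cycleTime k).add (by fun_prop)) measurableSet_Ioc

/-- `ζ true` and `ζ false` are the on- and off-times of one edge: independent exponential variables
with rates `r true` and `r false`. -/
structure IsHoldingTimes {Ω : Type*} [MeasurableSpace Ω] (P : Measure Ω) (r : Bool → ℝ)
    (ζ : Bool → ℕ → Ω → ℝ) : Prop where
  measurable : ∀ b l, Measurable (ζ b l)
  law : ∀ b l, P.map (ζ b l) = expMeasure (r b)
  indep : iIndepFun (fun q : Bool × ℕ => ζ q.1 q.2) P

namespace IsHoldingTimes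

variable {Ω : Type*} [MeasurableSpace Ω] {P : Measure Ω} {r : Bool → ℝ} {ζ : Bool → ℕ → Ω → ℝ}

theorem ae_nonneg (h : IsHoldingTimes P r ζ) (hr : ∀ b, 0 < r b) :
    ∀ᵐ ω ∂P, ∀ b l, 0 ≤ ζ b l ω := by
  refine ae_all_iff.2 fun b => ae_all_iff.2 fun l => ?_
  have hnull : P (ζ b l ⁻¹' Set.Iio 0) = 0 := by
    rw [← Measure.map_apply (h.measurable b l) measurableSet_Iio, h.law]
    exact expMeasure_Iio_zero (hr b)
  exact measure_mono_null (fun ω (hω : ¬ 0 ≤ ζ b l ω) => not_le.1 hω) hnull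

theorem measurable_cycleTime (h : IsHoldingTimes P r ζ) (k : ℕ) :
    Measurable fun ω => cycleTime (fun b l => ζ b l ω) k :=
  (_root_.measurable_cycleTime k).comp
    (measurable_pi_iff.2 fun b => measurable_pi_iff.2 (h.measurable b))

theorem measure_cycleTime_le (h : IsHoldingTimes P r ζ) (hr : ∀ b, 0 < r b) (t : ℝ) (k : ℕ) :
    P {ω | cycleTime (fun b l => ζ b l ω) k ≤ t} ≤ expMeasure (r true) (Set.Iic t) ^ k := by
  have hind : iIndepFun (ζ true) P :=
    h.indep.precomp (g := fun l => (true, l)) fun _ _ hk => (Prod.ext_iff.1 hk).2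
  calc P {ω | cycleTime (fun b l => ζ b l ω) k ≤ t}
      ≤ P (⋂ l ∈ Finset.range k, ζ true l ⁻¹' Set.Iic t) := by
        refine measure_mono_ae ?_
        filter_upwards [h.ae_nonneg hr] with ω hω hc
        refine Set.mem_iInter₂.2 fun l hl => le_trans ?_ hc
        refine (Finset.single_le_sum (f := fun l => ζ true l ω) (fun l _ => hω true l) hl).trans ?_
        exact le_add_of_nonneg_left (Finset.sum_nonneg fun l _ => hω false l)
    _ = ∏ l ∈ Finset.range k, P (ζ true l ⁻¹' Set.Iic t) :=
        hind.measure_inter_preimage_eq_mul (Finset.range k) fun _ _ => measurableSet_Iic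
    _ = expMeasure (r true) (Set.Iic t) ^ k := by
        simp only [← Measure.map_apply (h.measurable true _) measurableSet_Iic, h.law,
          Finset.prod_const, Finset.card_range]

variable [IsProbabilityMeasure P]

theorem measure_phaseEnd_mem_Ioc_le (h : IsHoldingTimes P r ζ) (hr : ∀ b, 0 < r b) (s t : ℝ)
    (k : ℕ) (b : Bool) :
    P {ω | cycleTime (fun b l => ζ b l ω) k + ζ b k ω ∈ Set.Ioc s t} ≤
      ENNReal.ofReal (r b * (t - s)) * expMeasure (r true) (Set.Iic t) ^ k := by
  have hind : IndepFun (fun ω => cycleTime (fun b l => ζ b l ω) k) (ζ b k) P := by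
    have := h.indep.indepFun_finsetSum_of_notMem (fun q => h.measurable q.1 q.2)
      (s := Finset.univ ×ˢ Finset.range k) (i := (b, k)) (by simp)
    convert! this using 1
    ext ω
    simp only [cycleTime_eq_sum, Finset.sum_apply]
  exact (measure_add_mem_Ioc_le (hr b) (h.measurable_cycleTime k) (h.measurable b k) hind
    (h.law b k) s t).trans (mul_le_mul_right (h.measure_cycleTime_le hr t k) _)

theorem measure_cycleEnd_mem_Ioc_le (h : IsHoldingTimes P r ζ) (hr : ∀ b, 0 < r b) (s t : ℝ)
    (k : ℕ) :
    P {ω | cycleTime (fun b l => ζ b l ω) (k + 1) ∈ Set.Ioc s t} ≤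
      ENNReal.ofReal (r true * (t - s)) * expMeasure (r true) (Set.Iic t) ^ k := by
  have hm : Measurable fun ω => cycleTime (fun b l => ζ b l ω) k + ζ false k ω :=
    (h.measurable_cycleTime k).add (h.measurable false k)
  have hind : IndepFun (fun ω => cycleTime (fun b l => ζ b l ω) k + ζ false k ω) (ζ true k) P := by
    have := h.indep.indepFun_finsetSum_of_notMem (fun q => h.measurable q.1 q.2)
      (s := insert (false, k) (Finset.univ ×ˢ Finset.range k)) (i := (true, k)) (by simp)
    convert! this using 1
    ext ω
    rw [Finset.sum_insert (by simp), cycleTime_eq_sum, Pi.add_apply, Finset.sum_apply, add_comm]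
  simp only [cycleTime_succ]
  refine (measure_add_mem_Ioc_le (hr true) hm (h.measurable true k) hind (h.law true k) s t).trans
    (mul_le_mul_right ((measure_mono_ae ?_).trans (h.measure_cycleTime_le hr t k)) _)
  filter_upwards [h.ae_nonneg hr] with ω hω (hle : _ ≤ t)
  exact (le_add_of_nonneg_right (hω false k)).trans hle

theorem measure_mem_switchSet_le (h : IsHoldingTimes P r ζ) (hr : ∀ b, 0 < r b) {s t : ℝ}
    (ht : 0 ≤ t) (hst : s ≤ t) :
    P {ω | (fun b l => ζ b l ω) ∈ switchSet s t} ≤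
      ENNReal.ofReal ((r false + 2 * r true) * Real.exp (r true * t) * (t - s)) := by
  set ρ := expMeasure (r true) (Set.Iic t) with hρ
  have hunion : {ω | (fun b l => ζ b l ω) ∈ switchSet s t} =
      ⋃ k, ({ω | cycleTime (fun b l => ζ b l ω) (k + 1) ∈ Set.Ioc s t} ∪
        ⋃ b, {ω | cycleTime (fun b l => ζ b l ω) k + ζ b k ω ∈ Set.Ioc s t}) := by
    ext ω
    simp [switchSet]
  calc P {ω | (fun b l => ζ b l ω) ∈ switchSet s t}
      ≤ ∑' k, (ENNReal.ofReal (r true * (t - s)) * ρ ^ k +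
          ∑ b, ENNReal.ofReal (r b * (t - s)) * ρ ^ k) := by
        rw [hunion]
        refine (measure_iUnion_le _).trans (ENNReal.tsum_le_tsum fun k =>
          (measure_union_le _ _).trans (add_le_add (h.measure_cycleEnd_mem_Ioc_le hr s t k) ?_))
        exact (measure_iUnion_fintype_le _ _).trans
          (Finset.sum_le_sum fun b _ => h.measure_phaseEnd_mem_Ioc_le hr s t k b)
    _ = ENNReal.ofReal ((r false + 2 * r true) * (t - s)) * ∑' k, ρ ^ k := by
        rw [← ENNReal.tsum_mul_left]
        refine tsum_congr fun k => ?_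
        have h0 := mul_nonneg (hr false).le (sub_nonneg.2 hst)
        have h1 := mul_nonneg (hr true).le (sub_nonneg.2 hst)
        rw [Fintype.sum_bool, ← add_mul, ← add_mul, ← ENNReal.ofReal_add h1 h0,
          ← ENNReal.ofReal_add h1 (add_nonneg h1 h0)]
        congr 2
        ring
    _ = ENNReal.ofReal ((r false + 2 * r true) * Real.exp (r true * t) * (t - s)) := by
        rw [ENNReal.tsum_geometric, hρ, one_sub_expMeasure_Iic (hr true) ht,
          ← ENNReal.ofReal_inv_of_pos (Real.exp_pos _), ← Real.exp_neg, neg_neg,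
          ← ENNReal.ofReal_mul' (Real.exp_pos _).le]
        congr 1
        ring

end IsHoldingTimes

end SwitchingTimes

section EdgeInput

theorem iIndepFun_sigma_curry {Ω ι : Type*} [MeasurableSpace Ω] {P : Measure Ω}
    [IsProbabilityMeasure P] {κ : ι → Type*} {S : (i : ι) → κ i → Type*}
    [∀ i k, MeasurableSpace (S i k)] {X : (i : ι) → (k : κ i) → Ω → S i k}
    (hm : ∀ i k, Measurable (X i k)) (hX : iIndepFun (fun q : (i : ι) × κ i => X q.1 q.2) P) :
    iIndepFun (fun i ω k => X i k ω) P := by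
  have := fun i k => Measure.isProbabilityMeasure_map (μ := P) (hm i k).aemeasurable
  have hrow : ∀ i, P.map (fun ω k => X i k ω) = Measure.infinitePi fun k => P.map (X i k) :=
    fun i => (hX.precomp (g := Sigma.mk i) sigma_mk_injective).map_fun_eq_infinitePi_map (hm i)
  have hall := hX.map_fun_eq_infinitePi_map fun q : (i : ι) × κ i => hm q.1 q.2
  rw [iIndepFun_iff_map_fun_eq_infinitePi_map fun i => measurable_pi_iff.2 (hm i)]
  simp only [hrow]
  rw [← Measure.infinitePi_map_piCurry fun i k => P.map (X i k), ← hall,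
    Measure.map_map (by fun_prop) (measurable_pi_iff.2 fun q : (i : ι) × κ i => hm q.1 q.2)]
  rfl

variable {Ω : Type*} {N : ℕ}

/-- All the randomness attached to the edge `e`, as one family of real numbers: the index `none`
carries the initial state, encoded as `0` or `1`, and `some (b, l)` the holding time `ξ b e l`. -/
def edgeInput (init : Sym2 (Fin N) → Ω → Bool) (ξ : Bool → Sym2 (Fin N) → ℕ → Ω → ℝ)
    (e : Sym2 (Fin N)) (ω : Ω) : Option (Bool × ℕ) → ℝ
  | none => ((init e ω).toNat : ℝ)
  | some (b, l) => ξ b e l ω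

/-- The holding times recorded in the input of an edge. -/
def inputTimes (z : Option (Bool × ℕ) → ℝ) (b : Bool) (l : ℕ) : ℝ := z (some (b, l))

/-- Whether an edge with input `z` is present at time `t`. -/
noncomputable def inputState (t : ℝ) (z : Option (Bool × ℕ) → ℝ) : Bool :=
  decide (onOffState (decide (z none = 1)) (inputTimes z) t = 1)

open Classical in
/-- Whether an edge with input `z` may switch during `(s, t]`. -/
noncomputable def inputSwitch (s t : ℝ) (z : Option (Bool × ℕ) → ℝ) : Bool :=
  decide (inputTimes z ∈ switchSet s t)

/-- The edges present at time `t`. -/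
noncomputable def edgeConfig (init : Sym2 (Fin N) → Ω → Bool)
    (ξ : Bool → Sym2 (Fin N) → ℕ → Ω → ℝ) (t : ℝ) (ω : Ω) (e : Sym2 (Fin N)) : Bool :=
  inputState t (edgeInput init ξ e ω)

/-- The edges that may switch during `(s, t]`. -/
noncomputable def switchConfig (init : Sym2 (Fin N) → Ω → Bool)
    (ξ : Bool → Sym2 (Fin N) → ℕ → Ω → ℝ) (s t : ℝ) (ω : Ω) (e : Sym2 (Fin N)) : Bool :=
  inputSwitch s t (edgeInput init ξ e ω)

theorem inputState_eq_of_inputSwitch_eq_false {s t t' : ℝ} (hs : 0 ≤ s) (hst : s ≤ t)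
    (htt' : t ≤ t') {z : Option (Bool × ℕ) → ℝ} (h : inputSwitch s t' z = false) :
    inputState t z = inputState s z := by
  have hz : inputTimes z ∉ switchSet s t' := by simpa [inputSwitch] using h
  simp only [inputState, onOffState_eq_of_notMem_switchSet hs hz hst htt']

theorem measurable_inputTimes : Measurable inputTimes := by
  unfold inputTimes
  fun_prop

theorem measurable_inputState (t : ℝ) : Measurable (inputState t) := by
  have hstate : Measurable fun z : Option (Bool × ℕ) → ℝ =>
      onOffState (decide (z none = 1)) (inputTimes z) t := by
    have hinit : Measurable fun z : Option (Bool × ℕ) → ℝ => decide (z none = 1) := by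
      have hnone : Measurable fun z : Option (Bool × ℕ) → ℝ => z none := by fun_prop
      refine measurable_to_bool ?_
      simpa [Set.preimage] using hnone (measurableSet_singleton 1)
    exact (measurable_from_prod_countable_right
      (f := fun q : Bool × (Bool → ℕ → ℝ) => onOffState q.1 q.2 t)
      fun b => measurable_onOffState b t).comp (hinit.prodMk measurable_inputTimes)
  refine measurable_to_bool ?_
  simpa [Set.preimage, inputState] using hstate (measurableSet_singleton 1)

theorem measurable_inputSwitch (s t : ℝ) : Measurable (inputSwitch s t) := by
  refine measurable_to_bool ?_
  simpa [Set.preimage, inputSwitch] using measurable_inputTimes (measurableSet_switchSet s t)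

section InputConfigurations

variable (init : Sym2 (Fin N) → Ω → Bool) (ξ : Bool → Sym2 (Fin N) → ℕ → Ω → ℝ)

theorem edgeProcess_eq_ite (e : Sym2 (Fin N)) (t : ℝ) (ω : Ω) :
    edgeProcess init ξ e t ω = if edgeConfig init ξ t ω e then 1 else 0 := by
  have hinput : edgeConfig init ξ t ω e = decide (edgeProcess init ξ e t ω = 1) := by
    unfold edgeConfig inputState edgeProcess inputTimes edgeInput
    cases init e ω <;> simp
  rw [hinput]
  rcases onOffState_eq_zero_or_one (init e ω) (fun b l => ξ b e l ω) t with h | h <;>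
    simp [edgeProcess, h]

theorem adjacencyProcess_eq_configMatrix (t : ℝ) (ω : Ω) :
    adjacencyProcess init ξ t ω = configMatrix (edgeConfig init ξ t ω) := by
  ext i j
  exact edgeProcess_eq_ite init ξ s(i, j) t ω

theorem edgeProb_eq [MeasurableSpace Ω] (P : Measure Ω) (e : Sym2 (Fin N)) (t : ℝ) :
    edgeProb P init ξ e t = P.real {ω | edgeConfig init ξ t ω e = true} := by
  simp [edgeProb, edgeProcess_eq_ite]

end InputConfigurations

namespace IsOnOffInput

variable [MeasurableSpace Ω] {P : Measure Ω} {p₀ lon loff : ℝ}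
  {init : Sym2 (Fin N) → Ω → Bool} {ξ : Bool → Sym2 (Fin N) → ℕ → Ω → ℝ}

theorem measurable_edgeInput (h : IsOnOffInput P p₀ lon loff init ξ) (e : Sym2 (Fin N)) :
    Measurable (edgeInput init ξ e) := by
  refine measurable_pi_iff.2 ?_
  rintro (_ | ⟨b, l⟩)
  · exact (measurable_from_top (f := fun b : Bool => (b.toNat : ℝ))).comp (h.measurable_init e)
  · exact h.measurable_time b e l

theorem iIndepFun_edgeInput_sigma (h : IsOnOffInput P p₀ lon loff init ξ) :
    iIndepFun (fun (q : (_ : Sym2 (Fin N)) × Option (Bool × ℕ)) ω =>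
      edgeInput init ξ q.1 ω q.2) P := by
  let g : (_ : Sym2 (Fin N)) × Option (Bool × ℕ) → Sym2 (Fin N) ⊕ (Bool × Sym2 (Fin N) × ℕ)
    | ⟨e, none⟩ => Sum.inl e
    | ⟨e, some (b, l)⟩ => Sum.inr (b, e, l)
  have hg : Function.Injective g := by
    rintro ⟨e, _ | ⟨b, l⟩⟩ ⟨e', _ | ⟨b', l'⟩⟩ hq <;> simp_all [g]
  have := h.indep.precomp hg
  convert! this using 1
  ext ⟨e, _ | ⟨b, l⟩⟩ <;> rfl

theorem iIndepFun_edgeInput_apply (h : IsOnOffInput P p₀ lon loff init ξ) (e : Sym2 (Fin N)) :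
    iIndepFun (fun k ω => edgeInput init ξ e ω k) P :=
  h.iIndepFun_edgeInput_sigma.precomp (g := Sigma.mk e) sigma_mk_injective

theorem isHoldingTimes (h : IsOnOffInput P p₀ lon loff init ξ) (e : Sym2 (Fin N)) :
    IsHoldingTimes P (fun b => if b then lon else loff) fun b => ξ b e where
  measurable b := h.measurable_time b e
  law
    | true => h.law_on e
    | false => h.law_off e
  indep := (h.iIndepFun_edgeInput_apply e).precomp (Option.some_injective _)

theorem measurable_edgeConfig (h : IsOnOffInput P p₀ lon loff init ξ) (t : ℝ) :
    Measurable (edgeConfig init ξ t) :=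
  measurable_pi_iff.2 fun e => (measurable_inputState t).comp (h.measurable_edgeInput e)

theorem measurable_switchConfig (h : IsOnOffInput P p₀ lon loff init ξ) (s t : ℝ) :
    Measurable (switchConfig init ξ s t) :=
  measurable_pi_iff.2 fun e => (measurable_inputSwitch s t).comp (h.measurable_edgeInput e)

variable [IsProbabilityMeasure P]

theorem iIndepFun_edgeInput (h : IsOnOffInput P p₀ lon loff init ξ) :
    iIndepFun (edgeInput init ξ) P :=
  iIndepFun_sigma_curry (fun e k => (measurable_pi_apply k).comp (h.measurable_edgeInput e))
    h.iIndepFun_edgeInput_sigma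

theorem map_init_eq (h : IsOnOffInput P p₀ lon loff init ξ) (e e' : Sym2 (Fin N)) :
    P.map (init e) = P.map (init e') := by
  have htrue : ∀ e, P.map (init e) {true} = ENNReal.ofReal p₀ := fun e => by
    rw [Measure.map_apply (h.measurable_init e) (measurableSet_singleton _), ← h.law_init e]
    rfl
  have hfalse : ∀ e, P.map (init e) {false} = 1 - ENNReal.ofReal p₀ := fun e => by
    have := Measure.isProbabilityMeasure_map (h.measurable_init e).aemeasurable (μ := P)
    rw [← htrue e, ← prob_compl_eq_one_sub (measurableSet_singleton true), Bool.compl_singleton,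
      Bool.not_true]
  refine Measure.ext_of_singleton fun b => ?_
  cases b
  · rw [hfalse, hfalse]
  · rw [htrue, htrue]

theorem map_edgeInput_eq (h : IsOnOffInput P p₀ lon loff init ξ) (e e' : Sym2 (Fin N)) :
    P.map (edgeInput init ξ e) = P.map (edgeInput init ξ e') := by
  have hlaw : ∀ e, P.map (edgeInput init ξ e) =
      Measure.infinitePi fun k => P.map fun ω => edgeInput init ξ e ω k := fun e =>
    (h.iIndepFun_edgeInput_apply e).map_fun_eq_infinitePi_map
      fun k => (measurable_pi_apply k).comp (h.measurable_edgeInput e)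
  rw [hlaw, hlaw]
  congr 1
  ext1 k
  rcases k with _ | ⟨b | b, l⟩
  · have hnone : ∀ e, (P.map fun ω => edgeInput init ξ e ω none) =
        (P.map (init e)).map fun b : Bool => (b.toNat : ℝ) := fun e => by
      rw [Measure.map_map measurable_from_top (h.measurable_init e)]
      rfl
    rw [hnone, hnone, h.map_init_eq e e']
  · exact (h.law_off e l).trans (h.law_off e' l).symm
  · exact (h.law_on e l).trans (h.law_on e' l).symm

theorem map_comp_edgeInput_eq_pi (h : IsOnOffInput P p₀ lon loff init ξ)
    {f : (Option (Bool × ℕ) → ℝ) → Bool} (hf : Measurable f) (e₀ : Sym2 (Fin N)) :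
    P.map (fun ω e => f (edgeInput init ξ e ω)) =
      Measure.pi fun _ => P.map fun ω => f (edgeInput init ξ e₀ ω) := by
  have hm := fun e => hf.comp (h.measurable_edgeInput e)
  have hlaw : ∀ e, P.map (f ∘ edgeInput init ξ e) = P.map (f ∘ edgeInput init ξ e₀) := fun e => by
    rw [← Measure.map_map hf (h.measurable_edgeInput e), h.map_edgeInput_eq e e₀,
      Measure.map_map hf (h.measurable_edgeInput e₀)]
  have hpi := (h.iIndepFun_edgeInput.comp (fun _ => f) fun _ => hf).map_fun_eq_pi_map
    fun e => (hm e).aemeasurable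
  simp only [hlaw] at hpi
  exact hpi

theorem edgeProb_congr (h : IsOnOffInput P p₀ lon loff init ξ) (e e' : Sym2 (Fin N)) (t : ℝ) :
    edgeProb P init ξ e t = edgeProb P init ξ e' t := by
  have hlaw : ∀ e, edgeProb P init ξ e t =
      (P.map (edgeInput init ξ e)).real (inputState t ⁻¹' {true}) := fun e => by
    rw [edgeProb_eq, map_measureReal_apply (h.measurable_edgeInput e)
      (measurable_inputState t (measurableSet_singleton _))]
    rfl
  rw [hlaw, hlaw, h.map_edgeInput_eq e e']

theorem measureReal_switchConfig_le (h : IsOnOffInput P p₀ lon loff init ξ) (hlon : 0 < lon)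
    (hloff : 0 < loff) {s t : ℝ} (ht : 0 ≤ t) (hst : s ≤ t) (e : Sym2 (Fin N)) :
    P.real {ω | switchConfig init ξ s t ω e = true} ≤
      (loff + 2 * lon) * Real.exp (lon * t) * (t - s) := by
  have hswitch : {ω | switchConfig init ξ s t ω e = true} =
      {ω | (fun b l => ξ b e l ω) ∈ switchSet s t} := by
    ext ω
    simp only [switchConfig, inputSwitch, Set.mem_ofPred_eq, decide_eq_true_eq]
    rfl
  rw [hswitch]
  refine ENNReal.toReal_le_of_le_ofReal (mul_nonneg (by positivity) (sub_nonneg.2 hst)) ?_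
  simpa using (h.isHoldingTimes e).measure_mem_switchSet_le (by simp [hlon, hloff]) ht hst

theorem abs_edgeProb_sub_le (h : IsOnOffInput P p₀ lon loff init ξ) (e : Sym2 (Fin N))
    {s t t' : ℝ} (hs : 0 ≤ s) (hst : s ≤ t) (htt' : t ≤ t') :
    |edgeProb P init ξ e t - edgeProb P init ξ e s| ≤
      P.real {ω | switchConfig init ξ s t' ω e = true} := by
  have hmeas : ∀ t, MeasurableSet {ω | edgeConfig init ξ t ω e = true} := fun t =>
    measurable_pi_iff.1 (h.measurable_edgeConfig t) e (measurableSet_singleton true)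
  rw [edgeProb_eq, edgeProb_eq]
  refine (abs_measureReal_sub_le_measureReal_symmDiff (hmeas t).nullMeasurableSet
    (hmeas s).nullMeasurableSet).trans (measureReal_mono fun ω hω => ?_)
  by_contra hswitch
  have : edgeConfig init ξ t ω e = edgeConfig init ξ s ω e :=
    inputState_eq_of_inputSwitch_eq_false hs hst htt' (Bool.eq_false_iff.2 hswitch)
  simp [Set.mem_symmDiff, this] at hω

theorem le_edgeProb (h : IsOnOffInput P p₀ lon loff init ξ) (hp₀ : 0 ≤ p₀) (hlon : 0 < lon)
    {t : ℝ} (ht : 0 ≤ t) (e : Sym2 (Fin N)) :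
    p₀ * Real.exp (-(lon * t)) ≤ edgeProb P init ξ e t := by
  have := isProbabilityMeasure_expMeasure hlon
  have hind : IndepFun (fun ω => edgeInput init ξ e ω none)
      (fun ω => edgeInput init ξ e ω (some (true, 0))) P :=
    (h.iIndepFun_edgeInput_apply e).indepFun (by simp)
  have hinit : (fun ω => edgeInput init ξ e ω none) ⁻¹' {1} = {ω | init e ω = true} := by
    ext ω
    cases hi : init e ω <;> simp [edgeInput, hi]
  have hhold : P ((fun ω => edgeInput init ξ e ω (some (true, 0))) ⁻¹' Set.Ioi t) =
      ENNReal.ofReal (Real.exp (-(lon * t))) := by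
    rw [← one_sub_expMeasure_Iic hlon ht, ← prob_compl_eq_one_sub measurableSet_Iic, Set.compl_Iic,
      ← h.law_on e 0, Measure.map_apply (h.measurable_time true e 0) measurableSet_Ioi]
    rfl
  have hinter := hind.measure_inter_preimage_eq_mul {1} (Set.Ioi t) (measurableSet_singleton _)
    measurableSet_Ioi
  rw [hinit, hhold, h.law_init, ← ENNReal.ofReal_mul hp₀] at hinter
  refine (ENNReal.ofReal_le_iff_le_toReal (by finiteness)).1
    (hinter.symm.le.trans (measure_mono ?_))
  rintro ω ⟨(hi : init e ω = true), (hξ : t < ξ true e 0 ω)⟩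
  change onOffState _ _ _ = 1
  rw [onOffState, hi, if_pos ⟨0, by simp [cycleTime_zero, ht, hξ]⟩, if_pos rfl]

end IsOnOffInput

end EdgeInput

section Recentering

variable {Ω : Type*} [MeasurableSpace Ω] {P : Measure Ω} [IsProbabilityMeasure P] {E : Set Ω}
  {K B : ℝ}

theorem abs_integral_le_add_mul_measureReal_compl {f : Ω → ℝ} (hE : MeasurableSet E)
    (hK : 0 ≤ K) (hfE : ∀ ω ∈ E, |f ω| ≤ K) (hf : ∀ ω, |f ω| ≤ B) :
    |∫ ω, f ω ∂P| ≤ K + B * P.real Eᶜ := by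
  have hbound : ∀ ω, ‖f ω‖ ≤ K + Eᶜ.indicator (fun _ => B) ω := fun ω => by
    by_cases hω : ω ∈ E
    · simpa [hω] using hfE ω hω
    · simpa [hω] using (hf ω).trans (le_add_of_nonneg_left hK)
  have hint : Integrable (Eᶜ.indicator fun _ : Ω => B) P := (integrable_const B).indicator hE.compl
  calc |∫ ω, f ω ∂P| ≤ ∫ ω, (K + Eᶜ.indicator (fun _ => B) ω) ∂P :=
        norm_integral_le_of_norm_le ((integrable_const K).add hint) (.of_forall hbound)
    _ = K + B * P.real Eᶜ := by
        rw [integral_add (integrable_const K) hint, integral_indicator_const _ hE.compl]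
        simp [mul_comm]

theorem abs_sub_integral_sub_le {X Y : Ω → ℝ} {m : ℝ} (hX : Integrable X P)
    (hY : Integrable Y P) (hY0 : ∫ ω, Y ω ∂P = 0) (hE : MeasurableSet E) (hK : 0 ≤ K)
    (hXE : ∀ ω ∈ E, |X ω - m - Y ω| ≤ K) (hXB : ∀ ω, |X ω - m - Y ω| ≤ B) {ω : Ω} (hω : ω ∈ E) :
    |X ω - ∫ ω', X ω' ∂P - Y ω| ≤ 2 * K + B * P.real Eᶜ := by
  have hmean : ∫ ω, (X ω - m - Y ω) ∂P = ∫ ω, X ω ∂P - m := by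
    have hXm : Integrable (fun ω => X ω - m) P := hX.sub (integrable_const m)
    rw [integral_sub hXm hY, hY0, sub_zero, integral_sub hX (integrable_const m)]
    simp
  have hcenter : |∫ ω, X ω ∂P - m| ≤ K + B * P.real Eᶜ :=
    hmean ▸ abs_integral_le_add_mul_measureReal_compl hE hK hXE hXB
  calc |X ω - ∫ ω', X ω' ∂P - Y ω| = |(X ω - m - Y ω) - (∫ ω', X ω' ∂P - m)| := by ring_nf
    _ ≤ 2 * K + B * P.real Eᶜ := by
        linarith [abs_sub (X ω - m - Y ω) (∫ ω', X ω' ∂P - m), hXE ω hω]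

end Recentering

section DeterministicBounds

variable {N : ℕ}

theorem norm_matrixOp_le_sq {A : Matrix (Fin N) (Fin N) ℝ} (hA : ∀ i j, |A i j| ≤ 1) :
    ‖matrixOp A‖ ≤ N ^ 2 := by
  calc ‖matrixOp A‖ ≤ ∑ i, ∑ j, |A i j| := norm_matrixOp_le_sum_abs A
    _ ≤ ∑ _i : Fin N, ∑ _j : Fin N, 1 :=
        Finset.sum_le_sum fun i _ => Finset.sum_le_sum fun j _ => hA i j
    _ = N ^ 2 := by simp [sq]

theorem abs_principalEigenvalue_configMatrix_le [NeZero N] (x : Sym2 (Fin N) → Bool) :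
    |principalEigenvalue (configMatrix x)| ≤ N ^ 2 := by
  refine (abs_principalEigenvalue_le_norm (configMatrix_isHermitian x)).trans
    (norm_matrixOp_le_sq fun i j => ?_)
  simp only [configMatrix, Matrix.of_apply]
  split_ifs <;> simp

theorem abs_meanStat_le_sq [NeZero N] {p : ℝ} (hp : p ∈ Set.Icc (0 : ℝ) 1)
    (x : Sym2 (Fin N) → Bool) : |meanStat p x| ≤ N ^ 2 := by
  have he : ‖constUnit N‖ = 1 := norm_constUnit
  have hentry : ∀ i j, |centeredMatrix p x i j| ≤ 1 := fun i j => by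
    simp only [centeredMatrix, configMatrix, Matrix.of_apply]
    rw [abs_le]
    split_ifs <;> constructor <;> linarith [hp.1, hp.2]
  rw [← inner_matrixOp_constUnit]
  refine (abs_real_inner_le_norm _ _).trans ?_
  rw [he, mul_one]
  exact ((matrixOp (centeredMatrix p x)).unit_le_opNorm _ he.le).trans (norm_matrixOp_le_sq hentry)

theorem truncStat_mem_Icc [NeZero N] (M p : ℝ) (x : Sym2 (Fin N) → Bool) :
    truncStat M p x ∈ Set.Icc 0 (M ^ 2) := by
  have hN : (N : ℝ) ≠ 0 := NeZero.ne _
  refine ⟨mul_nonneg (by positivity) (Finset.sum_nonneg fun i _ => le_min (sq_nonneg _)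
    (sq_nonneg _)), ?_⟩
  calc (N : ℝ)⁻¹ * ∑ i, min (rowStat p i x ^ 2) (M ^ 2)
      ≤ (N : ℝ)⁻¹ * ∑ _i : Fin N, M ^ 2 := by gcongr; exact min_le_right _ _
    _ = M ^ 2 := by simp [hN]

theorem exists_grid_point {T t : ℝ} (hT : 0 < T) (ht : t ∈ Set.Icc 0 T) {n : ℕ} (hn : 1 ≤ n) :
    ∃ k ≤ n, k * (T / n) ≤ t ∧ t ≤ k * (T / n) + T / n := by
  have hn' : (0 : ℝ) < n := Nat.cast_pos.2 hn
  have hδ : 0 < T / n := by positivity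
  refine ⟨⌊t / (T / n)⌋₊, Nat.floor_le_of_le ?_, ?_, ?_⟩
  · rw [div_le_iff₀ hδ]
    exact ht.2.trans_eq (mul_div_cancel₀ T hn'.ne').symm
  · rw [← le_div_iff₀ hδ]
    exact Nat.floor_le (div_nonneg ht.1 hδ.le)
  · linarith [(div_lt_iff₀ hδ).1 (Nat.lt_floor_add_one (t / (T / n)))]

end DeterministicBounds

section DynamicExpansion

variable {Ω : Type*} [MeasurableSpace Ω] {N : ℕ}

/-- The mean of the truncated statistic of the graph at time `t`; `p(t)` is the probability of the
edge `e`, one value shared by all edges. -/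
noncomputable def truncMean (P : Measure Ω) (init : Sym2 (Fin N) → Ω → Bool)
    (ξ : Bool → Sym2 (Fin N) → ℕ → Ω → ℝ) (e : Sym2 (Fin N)) (L t : ℝ) : ℝ :=
  ∫ ω, truncStat (√N * L) (edgeProb P init ξ e t) (edgeConfig init ξ t ω) ∂P

/-- The event that the graph is typical at time `s` and that fewer than `L ^ 2` edges may switch
during `(s, t]`, so that the eigenvalue expansion holds throughout `[s, t]`. -/
def goodEvent (P : Measure Ω) (init : Sym2 (Fin N) → Ω → Bool)
    (ξ : Bool → Sym2 (Fin N) → ℕ → Ω → ℝ) (e : Sym2 (Fin N)) (L s t : ℝ) : Set Ω :=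
  {ω | IsTypicalConfig (8 * √N) L (√N * L ^ 2) (truncMean P init ξ e L s)
    (edgeProb P init ξ e s) (edgeConfig init ξ s ω) ∧
    ((Finset.univ.filter fun e => switchConfig init ξ s t ω e = true).card : ℝ) < L ^ 2}

/-- A bound for the probability that one of the `N ^ 2 + 1` good events of the time grid fails;
`a` bounds the expected number of switches in one interval of the grid. -/
noncomputable def failureBound (N : ℕ) (L a : ℝ) : ℝ :=
  (N ^ 2 + 1) * (2 * Real.exp (-N) + (2 * N + 4) * Real.exp (-L ^ 2 / 8) +
    Real.exp (-L ^ 2 + 2 * a))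

namespace IsOnOffInput

variable {P : Measure Ω} {p₀ lon loff : ℝ} {init : Sym2 (Fin N) → Ω → Bool}
  {ξ : Bool → Sym2 (Fin N) → ℕ → Ω → ℝ}

theorem measurableSet_goodEvent (h : IsOnOffInput P p₀ lon loff init ξ) (e : Sym2 (Fin N))
    (L s t : ℝ) : MeasurableSet (goodEvent P init ξ e L s t) :=
  (h.measurable_edgeConfig s (Set.toFinite {x | IsTypicalConfig (8 * √N) L (√N * L ^ 2)
    (truncMean P init ξ e L s) (edgeProb P init ξ e s) x}).measurableSet).inter
    (h.measurable_switchConfig s t (Set.toFinite {x : Sym2 (Fin N) → Bool |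
      ((Finset.univ.filter fun e => x e = true).card : ℝ) < L ^ 2}).measurableSet)

theorem map_edgeConfig_real_true (h : IsOnOffInput P p₀ lon loff init ξ) (e : Sym2 (Fin N))
    (t : ℝ) : (P.map fun ω => edgeConfig init ξ t ω e).real {true} = edgeProb P init ξ e t := by
  rw [map_measureReal_apply (measurable_pi_iff.1 (h.measurable_edgeConfig t) e)
    (measurableSet_singleton _), edgeProb_eq]
  rfl

variable [IsProbabilityMeasure P]

theorem map_edgeConfig_eq_pi (h : IsOnOffInput P p₀ lon loff init ξ) (e : Sym2 (Fin N)) (t : ℝ) :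
    P.map (edgeConfig init ξ t) = Measure.pi fun _ => P.map fun ω => edgeConfig init ξ t ω e :=
  h.map_comp_edgeInput_eq_pi (measurable_inputState t) e

theorem integrable_comp_edgeConfig (h : IsOnOffInput P p₀ lon loff init ξ) (t : ℝ)
    (f : (Sym2 (Fin N) → Bool) → ℝ) : Integrable (fun ω => f (edgeConfig init ξ t ω)) P :=
  (Integrable.of_finite (μ := P.map (edgeConfig init ξ t))).comp_measurable
    (h.measurable_edgeConfig t)

theorem integral_comp_edgeConfig (h : IsOnOffInput P p₀ lon loff init ξ) (e : Sym2 (Fin N))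
    (t : ℝ) (f : (Sym2 (Fin N) → Bool) → ℝ) :
    ∫ ω, f (edgeConfig init ξ t ω) ∂P =
      ∫ x, f x ∂Measure.pi fun _ => P.map fun ω => edgeConfig init ξ t ω e := by
  rw [← h.map_edgeConfig_eq_pi e t]
  exact (integral_map (h.measurable_edgeConfig t).aemeasurable
    (measurable_of_finite f).aestronglyMeasurable).symm

theorem integral_meanStat_edgeConfig (h : IsOnOffInput P p₀ lon loff init ξ) (e : Sym2 (Fin N))
    (t : ℝ) : ∫ ω, meanStat (edgeProb P init ξ e t) (edgeConfig init ξ t ω) ∂P = 0 := by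
  have := Measure.isProbabilityMeasure_map (μ := P)
    (measurable_pi_iff.1 (h.measurable_edgeConfig t) e).aemeasurable
  rw [h.integral_comp_edgeConfig e, ← h.map_edgeConfig_real_true e t, meanStat_eq_linearStat]
  exact integral_linearStat _ _

theorem measureReal_not_isTypicalConfig_edgeConfig_le [NeZero N]
    (h : IsOnOffInput P p₀ lon loff init ξ) (e : Sym2 (Fin N)) (L : ℝ≥0) (t : ℝ) :
    P.real {ω | ¬ IsTypicalConfig (8 * √N) L (√N * L ^ 2) (truncMean P init ξ e L t)
      (edgeProb P init ξ e t) (edgeConfig init ξ t ω)} ≤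
      2 * Real.exp (-N) + (2 * N + 4) * Real.exp (-L ^ 2 / 8) := by
  have := Measure.isProbabilityMeasure_map (μ := P)
    (measurable_pi_iff.1 (h.measurable_edgeConfig t) e).aemeasurable
  have hμ := measureReal_not_isTypicalConfig_le (N := N)
    (P.map fun ω => edgeConfig init ξ t ω e) L
  rw [← h.integral_comp_edgeConfig e, ← h.map_edgeConfig_eq_pi e, h.map_edgeConfig_real_true e,
    map_measureReal_apply (h.measurable_edgeConfig t) (Set.toFinite _).measurableSet] at hμ
  exact hμ

theorem measureReal_le_card_switchConfig_le (h : IsOnOffInput P p₀ lon loff init ξ)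
    (e : Sym2 (Fin N)) (s t m : ℝ) :
    P.real {ω | m ≤ (Finset.univ.filter fun e => switchConfig init ξ s t ω e = true).card} ≤
      Real.exp (-m + 2 * (N ^ 2 * P.real {ω | switchConfig init ξ s t ω e = true})) := by
  have hmeas := measurable_pi_iff.1 (h.measurable_switchConfig s t) e
  have := Measure.isProbabilityMeasure_map (μ := P) hmeas.aemeasurable
  have hpi : P.map (switchConfig init ξ s t) =
      Measure.pi fun _ => P.map fun ω => switchConfig init ξ s t ω e :=
    h.map_comp_edgeInput_eq_pi (measurable_inputSwitch s t) e
  have hcard : (Fintype.card (Sym2 (Fin N)) : ℝ) ≤ N ^ 2 := by exact_mod_cast card_sym2_fin_le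
  have hμ := measureReal_le_card_true_le (ι := Sym2 (Fin N))
    (P.map fun ω => switchConfig init ξ s t ω e) m
  rw [← hpi, map_measureReal_apply (h.measurable_switchConfig s t) (Set.toFinite _).measurableSet,
    map_measureReal_apply hmeas (measurableSet_singleton _)] at hμ
  refine hμ.trans (Real.exp_le_exp.2 (add_le_add_right ?_ _))
  calc 2 * P.real {ω | switchConfig init ξ s t ω e = true} * Fintype.card (Sym2 (Fin N))
      ≤ 2 * P.real {ω | switchConfig init ξ s t ω e = true} * N ^ 2 := by gcongr
    _ = 2 * (N ^ 2 * P.real {ω | switchConfig init ξ s t ω e = true}) := by ring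

theorem measureReal_compl_goodEvent_le [NeZero N] (h : IsOnOffInput P p₀ lon loff init ξ)
    {e : Sym2 (Fin N)} {L s t a : ℝ} (hL : 0 ≤ L)
    (ha : N ^ 2 * P.real {ω | switchConfig init ξ s t ω e = true} ≤ a) :
    P.real (goodEvent P init ξ e L s t)ᶜ ≤
      2 * Real.exp (-N) + (2 * N + 4) * Real.exp (-L ^ 2 / 8) + Real.exp (-L ^ 2 + 2 * a) := by
  have hcompl : (goodEvent P init ξ e L s t)ᶜ =
      {ω | ¬ IsTypicalConfig (8 * √N) L (√N * L ^ 2) (truncMean P init ξ e L s)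
        (edgeProb P init ξ e s) (edgeConfig init ξ s ω)} ∪
      {ω | L ^ 2 ≤ (Finset.univ.filter fun e => switchConfig init ξ s t ω e = true).card} := by
    ext ω
    simp only [goodEvent, Set.mem_compl_iff, Set.mem_union, Set.mem_ofPred_eq, not_and_or, not_lt]
  rw [hcompl]
  refine (measureReal_union_le _ _).trans (add_le_add
    (h.measureReal_not_isTypicalConfig_edgeConfig_le e ⟨L, hL⟩ s)
    ((h.measureReal_le_card_switchConfig_le e s t _).trans (Real.exp_le_exp.2 ?_)))
  gcongr

theorem abs_principalEigenvalue_sub_le_of_mem_goodEvent [NeZero N]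
    (h : IsOnOffInput P p₀ lon loff init ξ) {e : Sym2 (Fin N)} {L s t t' a c : ℝ} {ω : Ω}
    (hω : ω ∈ goodEvent P init ξ e L s t') (hs : 0 ≤ s) (hst : s ≤ t) (htt' : t ≤ t')
    (ha : N ^ 2 * P.real {ω | switchConfig init ξ s t' ω e = true} ≤ a)
    (hD : 2 * L ^ 2 + a ≤ √N) (hL : 1 ≤ L) (hc : 0 < c) (hcp : c ≤ edgeProb P init ξ e t)
    (hNc : 36 * √N ≤ N * c) :
    |principalEigenvalue (configMatrix (edgeConfig init ξ t ω)) -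
      (N * edgeProb P init ξ e t + truncMean P init ξ e L s / (N * edgeProb P init ξ e t)) -
      meanStat (edgeProb P init ξ e t) (edgeConfig init ξ t ω)| ≤
      7400 / c ^ 2 * (L ^ 2 / √N) := by
  refine hω.1.abs_principalEigenvalue_sub_le_of_near
    (S := Finset.univ.filter fun e => switchConfig init ξ s t' ω e = true) (fun e he => ?_) ?_
    hL hc hcp measureReal_le_one hNc
  · exact inputState_eq_of_inputSwitch_eq_false hs hst htt'
      (Bool.eq_false_iff.2 fun hswitch => he (Finset.mem_filter.2 ⟨Finset.mem_univ e, hswitch⟩))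
  · have hp := mul_le_mul_of_nonneg_left (h.abs_edgeProb_sub_le e hs hst htt')
      (sq_nonneg (N : ℝ))
    linarith [hω.2]

theorem abs_center_le [NeZero N] {e : Sym2 (Fin N)} {L s t c : ℝ} (hc : 0 < c)
    (hcp : c ≤ edgeProb P init ξ e t) :
    |N * edgeProb P init ξ e t + truncMean P init ξ e L s / (N * edgeProb P init ξ e t)| ≤
      N + L ^ 2 / c := by
  have hN : (0 : ℝ) < N := Nat.cast_pos.2 (NeZero.pos N)
  have hp : 0 < edgeProb P init ξ e t := hc.trans_le hcp
  have hmem := fun ω => truncStat_mem_Icc (√N * L) (edgeProb P init ξ e s) (edgeConfig init ξ s ω)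
  have hnonneg : 0 ≤ truncMean P init ξ e L s := integral_nonneg fun ω => (hmem ω).1
  have hle : truncMean P init ξ e L s ≤ N * L ^ 2 := by
    refine (integral_mono_of_nonneg (.of_forall fun ω => (hmem ω).1) (integrable_const _)
      (.of_forall fun ω => (hmem ω).2)).trans_eq ?_
    simp [mul_pow]
  rw [abs_of_nonneg (by positivity)]
  refine add_le_add (mul_le_of_le_one_right hN.le measureReal_le_one) ?_
  calc truncMean P init ξ e L s / (N * edgeProb P init ξ e t)
      ≤ N * L ^ 2 / (N * c) := by gcongr
    _ = L ^ 2 / c := mul_div_mul_left _ _ hN.ne'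

theorem exists_event_abs_principalEigenvalue_sub_le [NeZero N]
    (h : IsOnOffInput P p₀ lon loff init ξ) {e : Sym2 (Fin N)} {T L c C : ℝ} (hT : 0 < T)
    (hL : 1 ≤ L) (hc : 0 < c) (hcp : ∀ t ∈ Set.Icc 0 T, c ≤ edgeProb P init ξ e t)
    (hC : ∀ s ∈ Set.Icc 0 T, ∀ δ ∈ Set.Icc 0 T,
      P.real {ω | switchConfig init ξ s (s + δ) ω e = true} ≤ C * δ)
    (hD : 2 * L ^ 2 + C * T ≤ √N) (hNc : 36 * √N ≤ N * c) :
    ∃ E : Set Ω, MeasurableSet E ∧ P.real Eᶜ ≤ failureBound N L (C * T) ∧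
      ∀ t ∈ Set.Icc 0 T, ∃ m : ℝ, |m| ≤ N + L ^ 2 / c ∧ ∀ ω ∈ E,
        |principalEigenvalue (configMatrix (edgeConfig init ξ t ω)) - m -
          meanStat (edgeProb P init ξ e t) (edgeConfig init ξ t ω)| ≤
          7400 / c ^ 2 * (L ^ 2 / √N) := by
  have hn : 1 ≤ N ^ 2 := Nat.one_le_pow _ _ NeZero.one_le
  have hn0 : (0 : ℝ) < (N ^ 2 : ℕ) := Nat.cast_pos.2 hn
  set δ : ℝ := T / (N ^ 2 : ℕ) with hδ
  have hδ0 : 0 ≤ δ := by positivity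
  have hδT : δ ≤ T := div_le_self hT.le (by exact_mod_cast hn)
  have hswitch : ∀ k ≤ N ^ 2,
      N ^ 2 * P.real {ω | switchConfig init ξ (k * δ) (k * δ + δ) ω e = true} ≤ C * T := by
    intro k hk
    have hkT : k * δ ≤ (N ^ 2 : ℕ) * δ := by gcongr
    rw [hδ, mul_div_cancel₀ T hn0.ne', ← hδ] at hkT
    calc (N : ℝ) ^ 2 * P.real {ω | switchConfig init ξ (k * δ) (k * δ + δ) ω e = true}
        ≤ N ^ 2 * (C * δ) := by gcongr; exact hC _ ⟨by positivity, hkT⟩ _ ⟨hδ0, hδT⟩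
      _ = C * T := by rw [mul_left_comm, hδ, ← Nat.cast_pow, mul_div_cancel₀ T hn0.ne']
  refine ⟨⋂ k ∈ Finset.range (N ^ 2 + 1), goodEvent P init ξ e L (k * δ) (k * δ + δ),
    Finset.measurableSet_biInter _ fun k _ => h.measurableSet_goodEvent e L _ _, ?_,
    fun t ht => ?_⟩
  · simp only [Set.compl_iInter]
    refine (measureReal_biUnion_finset_le _ _).trans ((Finset.sum_le_card_nsmul _ _ _ fun k hk =>
      h.measureReal_compl_goodEvent_le (zero_le_one.trans hL)
        (hswitch k (Finset.mem_range_succ_iff.1 hk))).trans_eq ?_)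
    rw [Finset.card_range, nsmul_eq_mul, Nat.cast_succ, Nat.cast_pow, failureBound]
  · obtain ⟨k, hk, hkt, htk⟩ := exists_grid_point hT ht hn
    refine ⟨_, abs_center_le (L := L) (s := k * δ) hc (hcp t ht), fun ω hω => ?_⟩
    exact h.abs_principalEigenvalue_sub_le_of_mem_goodEvent
      (Set.mem_iInter₂.1 hω k (Finset.mem_range_succ_iff.2 hk)) (by positivity) hkt htk
      (hswitch k hk) hD hL hc (hcp t ht) hNc

theorem exists_event_abs_principalEigenvalue_sub_integral_sub_le [NeZero N]
    (h : IsOnOffInput P p₀ lon loff init ξ) {e : Sym2 (Fin N)} {T L c C : ℝ} (hT : 0 < T)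
    (hL : 1 ≤ L) (hLN : L ≤ N) (hc : 0 < c)
    (hcp : ∀ t ∈ Set.Icc 0 T, c ≤ edgeProb P init ξ e t)
    (hC : ∀ s ∈ Set.Icc 0 T, ∀ δ ∈ Set.Icc 0 T,
      P.real {ω | switchConfig init ξ s (s + δ) ω e = true} ≤ C * δ)
    (hD : 2 * L ^ 2 + C * T ≤ √N) (hNc : 36 * √N ≤ N * c) :
    ∃ E : Set Ω, MeasurableSet E ∧ P.real Eᶜ ≤ failureBound N L (C * T) ∧
      ∀ t ∈ Set.Icc 0 T, ∀ ω ∈ E,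
        |principalEigenvalue (configMatrix (edgeConfig init ξ t ω)) -
          ∫ ω', principalEigenvalue (configMatrix (edgeConfig init ξ t ω')) ∂P -
          meanStat (edgeProb P init ξ e t) (edgeConfig init ξ t ω)| ≤
          14800 / c ^ 2 * (L ^ 2 / √N) + 4 * N ^ 2 / c * failureBound N L (C * T) := by
  obtain ⟨E, hE, hPE, hexp⟩ :=
    h.exists_event_abs_principalEigenvalue_sub_le hT hL hc hcp hC hD hNc
  refine ⟨E, hE, hPE, fun t ht ω hω => ?_⟩
  obtain ⟨m, hm, hmE⟩ := hexp t ht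
  have hN1 : (1 : ℝ) ≤ N := Nat.one_le_cast.2 NeZero.one_le
  have hbound : ∀ ω, |principalEigenvalue (configMatrix (edgeConfig init ξ t ω)) - m -
      meanStat (edgeProb P init ξ e t) (edgeConfig init ξ t ω)| ≤ 4 * N ^ 2 / c := fun ω => by
    have hNc : (N : ℝ) ^ 2 ≤ N ^ 2 / c :=
      le_div_self (by positivity) hc ((hcp t ht).trans measureReal_le_one)
    have hLc : L ^ 2 / c ≤ N ^ 2 / c := by gcongr
    rw [mul_div_assoc]
    refine (abs_sub _ _).trans ?_
    linarith [abs_sub (principalEigenvalue (configMatrix (edgeConfig init ξ t ω))) m,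
      abs_principalEigenvalue_configMatrix_le (edgeConfig init ξ t ω), le_self_pow₀ hN1 two_ne_zero,
      abs_meanStat_le_sq (p := edgeProb P init ξ e t) ⟨measureReal_nonneg, measureReal_le_one⟩
        (edgeConfig init ξ t ω)]
  refine (abs_sub_integral_sub_le
    (h.integrable_comp_edgeConfig t fun x => principalEigenvalue (configMatrix x))
    (h.integrable_comp_edgeConfig t (meanStat (edgeProb P init ξ e t)))
    (h.integral_meanStat_edgeConfig e t) hE (by positivity) hmE hbound hω).trans ?_
  rw [show 2 * (7400 / c ^ 2 * (L ^ 2 / √N)) = 14800 / c ^ 2 * (L ^ 2 / √N) by ring]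
  gcongr

end IsOnOffInput

end DynamicExpansion

section Asymptotics

open Filter

theorem tendsto_log_natCast_atTop : Tendsto (fun N : ℕ => Real.log N) atTop atTop :=
  Real.tendsto_log_atTop.comp tendsto_natCast_atTop_atTop

theorem tendsto_sqrt_natCast_atTop : Tendsto (fun N : ℕ => √(N : ℝ)) atTop atTop :=
  Real.tendsto_sqrt_atTop.comp tendsto_natCast_atTop_atTop

theorem eventually_two_mul_log_sq_add_le_sqrt (a : ℝ) :
    ∀ᶠ N : ℕ in atTop, 2 * Real.log N ^ 2 + a ≤ √N := by
  have hlog := ((Real.isLittleO_pow_log_id_atTop (n := 2)).comp_tendsto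
    tendsto_sqrt_natCast_atTop).bound (show (0 : ℝ) < 1 / 16 by norm_num)
  filter_upwards [hlog, tendsto_sqrt_natCast_atTop.eventually_ge_atTop (2 * a)] with N hlog ha
  simp only [Function.comp_apply, id_eq, Real.norm_eq_abs, abs_of_nonneg (Real.sqrt_nonneg _),
    Real.log_sqrt (Nat.cast_nonneg N)] at hlog
  rw [abs_of_nonneg (sq_nonneg _)] at hlog
  linarith

theorem eventually_mul_sqrt_le_mul (a : ℝ) {c : ℝ} (hc : 0 < c) :
    ∀ᶠ N : ℕ in atTop, a * √N ≤ N * c := by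
  filter_upwards [tendsto_sqrt_natCast_atTop.eventually_ge_atTop (a / c)] with N hN
  rw [div_le_iff₀ hc] at hN
  calc a * √N ≤ √N * c * √N := by gcongr
    _ = N * c := by rw [mul_right_comm, Real.mul_self_sqrt (Nat.cast_nonneg N)]

theorem eventually_mul_pow_three_mul_exp_le {a η η' : ℝ} (ha : 0 < a) (hη : η < η') :
    ∀ᶠ N : ℕ in atTop,
      a * N ^ 3 * Real.exp (-η' * Real.log N ^ 2) ≤ Real.exp (-η * Real.log N ^ 2) := by
  have hgap : 0 < η' - η := sub_pos.2 hη
  filter_upwards [tendsto_log_natCast_atTop.eventually_ge_atTop ((Real.log a + 3) / (η' - η)),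
    tendsto_log_natCast_atTop.eventually_ge_atTop (3 / (η' - η)),
    tendsto_log_natCast_atTop.eventually_ge_atTop 1, eventually_gt_atTop 0] with N h1 h2 h3 hN
  rw [div_le_iff₀ hgap] at h1 h2
  have hpow : a * (N : ℝ) ^ 3 = Real.exp (Real.log a + 3 * Real.log N) := by
    rw [show 3 * Real.log N = Real.log (N ^ 3 : ℝ) by simp, Real.exp_add, Real.exp_log ha,
      Real.exp_log (by positivity)]
  rw [hpow, ← Real.exp_add]
  refine Real.exp_le_exp.2 ?_
  nlinarith

theorem eventually_failureBound_le (a : ℝ) : ∀ᶠ N : ℕ in atTop,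
    failureBound N (Real.log N) a ≤ Real.exp (-(1 / 16) * Real.log N ^ 2) := by
  have hA : 0 < 2 * (8 + Real.exp (2 * a)) := by positivity
  filter_upwards [eventually_mul_pow_three_mul_exp_le hA (show (1 / 16 : ℝ) < 1 / 8 by norm_num),
    eventually_two_mul_log_sq_add_le_sqrt 0, eventually_ge_atTop 1] with N hpow hlog hN
  refine le_trans ?_ hpow
  have hN1 : (1 : ℝ) ≤ N := Nat.one_le_cast.2 hN
  have hsqrt : √(N : ℝ) ≤ N := Real.sqrt_le_self_iff.2 (.inr hN1)
  have hsq : 0 ≤ Real.log N ^ 2 := sq_nonneg _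
  have hnorm : Real.exp (-N) ≤ Real.exp (-(1 / 8) * Real.log N ^ 2) :=
    Real.exp_le_exp.2 (by linarith)
  have hswitch : Real.exp (-Real.log N ^ 2 + 2 * a) ≤
      Real.exp (2 * a) * Real.exp (-(1 / 8) * Real.log N ^ 2) := by
    rw [← Real.exp_add]
    exact Real.exp_le_exp.2 (by linarith)
  have htail : Real.exp (-Real.log N ^ 2 / 8) = Real.exp (-(1 / 8) * Real.log N ^ 2) := by ring_nf
  rw [failureBound, htail]
  set x := Real.exp (-(1 / 8) * Real.log N ^ 2)
  calc ((N : ℝ) ^ 2 + 1) * (2 * Real.exp (-N) + (2 * N + 4) * x +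
        Real.exp (-Real.log N ^ 2 + 2 * a))
      ≤ (N ^ 2 + N ^ 2) * (2 * x + (2 * N + 4) * x + Real.exp (2 * a) * x) := by
        gcongr
        exact one_le_pow₀ hN1
    _ = 2 * N ^ 2 * (2 * N + 6 * 1 + Real.exp (2 * a) * 1) * x := by ring
    _ ≤ 2 * N ^ 2 * (2 * N + 6 * N + Real.exp (2 * a) * N) * x := by gcongr
    _ = 2 * (8 + Real.exp (2 * a)) * N ^ 3 * x := by ring

theorem eventually_mul_sq_mul_exp_le {a : ℝ} (ha : 0 < a) :
    ∀ᶠ N : ℕ in atTop, a * N ^ 2 * Real.exp (-(1 / 16) * Real.log N ^ 2) ≤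
      Real.log N ^ 2 / √N := by
  filter_upwards [eventually_mul_pow_three_mul_exp_le ha (show (0 : ℝ) < 1 / 16 by norm_num),
    tendsto_log_natCast_atTop.eventually_ge_atTop 1, eventually_ge_atTop 1] with N hpow hlog hN
  have hN1 : (1 : ℝ) ≤ N := Nat.one_le_cast.2 hN
  rw [le_div_iff₀ (Real.sqrt_pos.2 (by linarith))]
  calc a * (N : ℝ) ^ 2 * Real.exp (-(1 / 16) * Real.log N ^ 2) * √N
      ≤ a * (N : ℝ) ^ 2 * Real.exp (-(1 / 16) * Real.log N ^ 2) * N := by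
        gcongr
        exact Real.sqrt_le_self_iff.2 (.inr hN1)
    _ = a * N ^ 3 * Real.exp (-(1 / 16) * Real.log N ^ 2) := by ring
    _ ≤ 1 := hpow.trans_eq (by simp)
    _ ≤ Real.log N ^ 2 := one_le_pow₀ hlog

theorem summable_exp_neg_mul_log_sq {η : ℝ} (hη : 0 < η) :
    Summable fun N : ℕ => Real.exp (-η * Real.log N ^ 2) := by
  refine Summable.of_norm_bounded_eventually_nat (g := fun N : ℕ => ((N : ℝ) ^ 2)⁻¹)
    (Real.summable_nat_pow_inv.2 one_lt_two) ?_
  filter_upwards [tendsto_log_natCast_atTop.eventually_ge_atTop (2 / η),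
    tendsto_log_natCast_atTop.eventually_ge_atTop 0, eventually_gt_atTop 0] with N hlog hlog0 hN
  rw [div_le_iff₀ hη] at hlog
  rw [Real.norm_of_nonneg (Real.exp_pos _).le, ← Real.exp_log (show (0 : ℝ) < N ^ 2 by positivity),
    ← Real.exp_neg, Real.log_pow]
  refine Real.exp_le_exp.2 ?_
  push_cast
  nlinarith

end Asymptotics

section BorelCantelli

open Filter

variable {Ω : Type*} [MeasurableSpace Ω] {P : Measure Ω} [IsProbabilityMeasure P] {b : ℕ → ℝ}

theorem exists_event_sequence {r : ℕ → ℝ} {Q : ℕ → Set Ω → Prop} (hb : ∀ N, 0 ≤ b N)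
    (hr : ∀ N, r N = 0 → 1 ≤ b N)
    (hQ : ∀ᶠ N in atTop, r N ≠ 0 ∧ ∃ E, MeasurableSet E ∧ P.real Eᶜ ≤ b N ∧ Q N E) :
    ∃ E : ℕ → Set Ω, (∀ N, MeasurableSet (E N) ∧ P.real (E N)ᶜ ≤ b N) ∧
      (∀ N, r N = 0 → E N = ∅) ∧ ∀ᶠ N in atTop, Q N (E N) := by
  obtain ⟨N₀, hN₀⟩ := eventually_atTop.1 hQ
  have hE : ∀ N, ∃ E, (MeasurableSet E ∧ P.real Eᶜ ≤ b N) ∧ (r N = 0 → E = ∅) ∧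
      (N₀ ≤ N → Q N E) := fun N => by
    by_cases hN : N₀ ≤ N
    · obtain ⟨hrN, E, hE, hPE, hQE⟩ := hN₀ N hN
      exact ⟨E, ⟨hE, hPE⟩, fun h0 => absurd h0 hrN, fun _ => hQE⟩
    by_cases hrN : r N = 0
    · exact ⟨∅, ⟨.empty, by simpa using hr N hrN⟩, fun _ => rfl, fun h => absurd h hN⟩
    · exact ⟨Set.univ, ⟨.univ, by simpa using hb N⟩, fun h => absurd h hrN, fun h => absurd h hN⟩
  choose E hE hE0 hEQ using hE
  exact ⟨E, hE, hE0, (eventually_ge_atTop N₀).mono hEQ⟩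

theorem ae_limsup_iSup_enorm_lt_top {τ : Type*} {S : Set τ} {E : ℕ → Set Ω} {K : ℝ}
    {G : ℕ → τ → Ω → ℝ} (hb : Summable b) (hE : ∀ N, P.real (E N)ᶜ ≤ b N)
    (hG : ∀ᶠ N in atTop, ∀ ω ∈ E N, ∀ t ∈ S, |G N t ω| ≤ K) :
    ∀ᵐ ω ∂P, limsup (fun N => ⨆ t ∈ S, ‖G N t ω‖ₑ) atTop < ⊤ := by
  have hsum : ∑' N, P (E N)ᶜ ≠ ⊤ := by
    have hP (N : ℕ) : P (E N)ᶜ = ENNReal.ofReal (P.real (E N)ᶜ) := by rw [ofReal_measureReal]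
    simp_rw [hP]
    exact (Summable.of_nonneg_of_le (fun _ => measureReal_nonneg) hE hb).tsum_ofReal_ne_top
  filter_upwards [ae_eventually_notMem hsum] with ω hω
  refine (limsup_le_of_le (h := ?_)).trans_lt (ENNReal.ofReal_lt_top (r := K))
  filter_upwards [hω, hG] with N hmem hGN
  refine iSup₂_le fun t ht => ?_
  rw [Real.enorm_eq_ofReal_abs]
  exact ENNReal.ofReal_le_ofReal (hGN ω (not_not.1 hmem) t ht)

end BorelCantelli

section ExpansionError

variable {Ω : Type*} [MeasurableSpace Ω] {P : Measure Ω} {N : ℕ} {p₀ lon loff T : ℝ}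

/-- The deviation of the principal eigenvalue at time `t` from its mean plus the linear statistic
`N⁻¹ ∑ (a_ij(t) - p(t))`. -/
noncomputable def expansionError (P : Measure Ω) (init : Sym2 (Fin N) → Ω → Bool)
    (ξ : Bool → Sym2 (Fin N) → ℕ → Ω → ℝ) (t : ℝ) (ω : Ω) : ℝ :=
  principalEigenvalue (adjacencyProcess init ξ t ω) -
    (∫ ω', principalEigenvalue (adjacencyProcess init ξ t ω') ∂P) -
    1 / (N : ℝ) * ∑ i : Fin N, ∑ j : Fin N,
      (edgeProcess init ξ s(i, j) t ω - edgeProb P init ξ s(i, j) t)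

theorem IsOnOffInput.measurable_expansionError {init : Sym2 (Fin N) → Ω → Bool}
    {ξ : Bool → Sym2 (Fin N) → ℕ → Ω → ℝ} (h : IsOnOffInput P p₀ lon loff init ξ) (t : ℝ) :
    Measurable (expansionError P init ξ t) := by
  unfold expansionError
  simp only [adjacencyProcess_eq_configMatrix, edgeProcess_eq_ite]
  exact (measurable_of_finite fun x : Sym2 (Fin N) → Bool =>
    principalEigenvalue (configMatrix x) -
      (∫ ω', principalEigenvalue (configMatrix (edgeConfig init ξ t ω')) ∂P) -
      1 / (N : ℝ) * ∑ i, ∑ j, ((if x s(i, j) then 1 else 0) - edgeProb P init ξ s(i, j) t)).comp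
    (h.measurable_edgeConfig t)

variable [IsProbabilityMeasure P]

theorem IsOnOffInput.expansionError_eq {init : Sym2 (Fin N) → Ω → Bool}
    {ξ : Bool → Sym2 (Fin N) → ℕ → Ω → ℝ} (h : IsOnOffInput P p₀ lon loff init ξ)
    (e : Sym2 (Fin N)) (t : ℝ) (ω : Ω) :
    expansionError P init ξ t ω = principalEigenvalue (configMatrix (edgeConfig init ξ t ω)) -
      (∫ ω', principalEigenvalue (configMatrix (edgeConfig init ξ t ω')) ∂P) -
      meanStat (edgeProb P init ξ e t) (edgeConfig init ξ t ω) := by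
  simp only [expansionError, adjacencyProcess_eq_configMatrix, edgeProcess_eq_ite,
    h.edgeProb_congr _ e, one_div]
  rfl

theorem IsOnOffInput.exists_event_abs_expansionError_le [NeZero N] {init : Sym2 (Fin N) → Ω → Bool}
    {ξ : Bool → Sym2 (Fin N) → ℕ → Ω → ℝ} (h : IsOnOffInput P p₀ lon loff init ξ) (hp₀ : 0 < p₀)
    (hlon : 0 < lon) (hloff : 0 < loff) (hT : 0 < T) {L c C : ℝ} (hL : 1 ≤ L) (hLN : L ≤ N)
    (hc : c = p₀ * Real.exp (-(lon * T))) (hC : C = (loff + 2 * lon) * Real.exp (lon * (T + T)))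
    (hD : 2 * L ^ 2 + C * T ≤ √N) (hNc : 36 * √N ≤ N * c) :
    ∃ E : Set Ω, MeasurableSet E ∧ P.real Eᶜ ≤ failureBound N L (C * T) ∧
      ∀ ω ∈ E, ∀ t ∈ Set.Icc 0 T, |expansionError P init ξ t ω| ≤
        14800 / c ^ 2 * (L ^ 2 / √N) + 4 * N ^ 2 / c * failureBound N L (C * T) := by
  have hc0 : 0 < c := by rw [hc]; positivity
  have hcp : ∀ t ∈ Set.Icc 0 T, c ≤ edgeProb P init ξ s(0, 0) t := fun t ht => by
    refine le_trans ?_ (h.le_edgeProb hp₀.le hlon ht.1 _)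
    rw [hc]
    gcongr
    exact ht.2
  have hswitch : ∀ s ∈ Set.Icc 0 T, ∀ δ ∈ Set.Icc 0 T,
      P.real {ω | switchConfig init ξ s (s + δ) ω s(0, 0) = true} ≤ C * δ := fun s hs δ hδ => by
    refine (h.measureReal_switchConfig_le hlon hloff (add_nonneg hs.1 hδ.1)
      (le_add_of_nonneg_right hδ.1) _).trans ?_
    rw [hC, add_sub_cancel_left]
    gcongr
    exacts [hδ.1, hs.2, hδ.2]
  obtain ⟨E, hE, hPE, herr⟩ := h.exists_event_abs_principalEigenvalue_sub_integral_sub_le hT hL hLN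
    hc0 hcp hswitch hD hNc
  refine ⟨E, hE, hPE, fun ω hω t ht => ?_⟩
  rw [h.expansionError_eq s(0, 0)]
  exact herr t ht ω hω

theorem exists_eventually_event_abs_expansionError_le {init : (N : ℕ) → Sym2 (Fin N) → Ω → Bool}
    {ξ : (N : ℕ) → Bool → Sym2 (Fin N) → ℕ → Ω → ℝ}
    (h : ∀ N, IsOnOffInput P p₀ lon loff (init N) (ξ N)) (hp₀ : 0 < p₀) (hlon : 0 < lon)
    (hloff : 0 < loff) (hT : 0 < T) :
    ∃ K : ℝ, ∀ᶠ N : ℕ in Filter.atTop, Real.log N ^ 4 / √N ≠ 0 ∧ ∃ E : Set Ω, MeasurableSet E ∧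
      P.real Eᶜ ≤ Real.exp (-(1 / 16) * Real.log N ^ 2) ∧ ∀ ω ∈ E, ∀ t ∈ Set.Icc 0 T,
        |expansionError P (init N) (ξ N) t ω / (Real.log N ^ 4 / √N)| ≤ K := by
  set c := p₀ * Real.exp (-(lon * T)) with hc
  set C := (loff + 2 * lon) * Real.exp (lon * (T + T)) with hC
  have hc0 : 0 < c := by positivity
  refine ⟨14800 / c ^ 2 + 1, ?_⟩
  filter_upwards [Filter.eventually_gt_atTop 0,
    tendsto_log_natCast_atTop.eventually_ge_atTop 1,
    eventually_two_mul_log_sq_add_le_sqrt (C * T), eventually_mul_sqrt_le_mul 36 hc0,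
    eventually_failureBound_le (C * T), eventually_mul_sq_mul_exp_le (div_pos four_pos hc0)]
    with N hN hL hD hNc hfail hsmall
  have : NeZero N := ⟨hN.ne'⟩
  have hrate : 0 < Real.log N ^ 4 / √N := by positivity
  obtain ⟨E, hE, hPE, herr⟩ := (h N).exists_event_abs_expansionError_le hp₀ hlon hloff hT hL
    (Real.log_le_self (Nat.cast_nonneg N)) hc hC hD hNc
  refine ⟨hrate.ne', E, hE, hPE.trans hfail, fun ω hω t ht => ?_⟩
  rw [abs_div, abs_of_pos hrate, div_le_iff₀ hrate]
  calc |expansionError P (init N) (ξ N) t ω|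
      ≤ 14800 / c ^ 2 * (Real.log N ^ 2 / √N) +
          4 / c * N ^ 2 * failureBound N (Real.log N) (C * T) :=
        (herr ω hω t ht).trans_eq (by rw [div_mul_eq_mul_div 4 c])
    _ ≤ 14800 / c ^ 2 * (Real.log N ^ 2 / √N) + Real.log N ^ 2 / √N := by
        grw [hfail, hsmall]
    _ = (14800 / c ^ 2 + 1) * (Real.log N ^ 2 / √N) := by ring
    _ ≤ (14800 / c ^ 2 + 1) * (Real.log N ^ 4 / √N) := by
        gcongr
        norm_num

end ExpansionError

theorem theorem3p2 {Ω : Type*} [MeasurableSpace Ω] (P : Measure Ω) [IsProbabilityMeasure P]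
    (p₀ lon loff T : ℝ) (hp₀ : p₀ ∈ Set.Ioo (0 : ℝ) 1) (hlon : 0 < lon) (hloff : 0 < loff)
    (hT : 0 < T)
    (init : (N : ℕ) → Sym2 (Fin N) → Ω → Bool)
    (ξ : (N : ℕ) → Bool → Sym2 (Fin N) → ℕ → Ω → ℝ)
    (hmodel : ∀ N : ℕ, IsOnOffInput P p₀ lon loff (init N) (ξ N)) :
    ∃ (η : ℝ) (E : ℕ → Set Ω) (G : ℕ → ℝ → Ω → ℝ),
      0 < η ∧
      (∀ N : ℕ, 1 ≤ N → MeasurableSet (E N) ∧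
        P.real (E N)ᶜ ≤ Real.exp (-η * (Real.log N) ^ 2)) ∧
      (∀ N : ℕ, 1 ≤ N → ∀ t ∈ Set.Icc (0 : ℝ) T, Measurable (G N t)) ∧
      (∀ N : ℕ, 1 ≤ N → ∀ ω ∈ E N, ∀ t ∈ Set.Icc (0 : ℝ) T,
        principalEigenvalue (adjacencyProcess (init N) (ξ N) t ω) =
          (∫ ω', principalEigenvalue (adjacencyProcess (init N) (ξ N) t ω') ∂P)
            + (1 / (N : ℝ)) * ∑ i : Fin N, ∑ j : Fin N,
                (edgeProcess (init N) (ξ N) s(i, j) t ω - edgeProb P (init N) (ξ N) s(i, j) t)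
            + G N t ω * ((Real.log N) ^ 4 / Real.sqrt N)) ∧
      (∀ᵐ ω ∂P, Filter.limsup (fun N : ℕ => ⨆ t ∈ Set.Icc (0 : ℝ) T, ‖G N t ω‖ₑ)
        Filter.atTop < ⊤) ∧
      (∃ C : ℝ, ∀ᶠ N : ℕ in Filter.atTop, ∀ ω ∈ E N, ∀ t ∈ Set.Icc (0 : ℝ) T,
        |G N t ω| ≤ C) := by
  have hη : (0 : ℝ) < 1 / 16 := by norm_num
  have hrate_zero (N : ℕ) (hN : Real.log N ^ 4 / √N = 0) :
      1 ≤ Real.exp (-(1 / 16) * Real.log N ^ 2) := by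
    rcases div_eq_zero_iff.1 hN with h0 | h0
    · simp [pow_eq_zero_iff four_ne_zero |>.1 h0]
    · simp [Nat.cast_eq_zero.1 ((Real.sqrt_eq_zero (Nat.cast_nonneg N)).1 h0)]
  obtain ⟨K, hK⟩ := exists_eventually_event_abs_expansionError_le hmodel hp₀.1 hlon hloff hT
  obtain ⟨E, hE, hE_empty, hbound⟩ :=
    exists_event_sequence (fun N : ℕ => (Real.exp_pos _).le) hrate_zero hK
  refine ⟨1 / 16, E, fun N t ω => expansionError P (init N) (ξ N) t ω / (Real.log N ^ 4 / √N),
    hη, fun N _ => hE N, fun N _ t _ => ((hmodel N).measurable_expansionError t).div_const _,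
    fun N _ ω hω t _ => ?_,
    ae_limsup_iSup_enorm_lt_top (summable_exp_neg_mul_log_sq hη) (fun N => (hE N).2) hbound,
    K, hbound⟩
  have hrate : Real.log N ^ 4 / √N ≠ 0 := fun h0 => by simp [hE_empty N h0] at hω
  rw [div_mul_cancel₀ _ hrate, expansionError]
  ring
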